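/- **Conventions.** Manifolds are topological manifolds (Hausdorff, second countable). For a space $X$ let $C_*(X;\mathbb R)$ be the singular chain complex, and let $C_*^\square(X;\mathbb R)=Q_*(X;\mathbb R)/D_*(X;\mathbb R)$ be the cubical singular chain complex, i.e., the chain complex freely generated by the continuous maps $[0,1]^n\to X$, with the boundary operator $\partial c=\sum_{j=1}^n(-1)^j\bigl(c|_{x_j=0}-c|_{x_j=1}\bigr)$, modulo the subcomplex generated by the degenerate cubes (those that are independent of one of the coordinates). Both are equipped with the norm $|\cdot|$ induced by the $\ell^1$-norm with respect to singular simplices and singular cubes, respectively. Let $F$ be one of these two functors. For $A\subset X$ put $F(X,A)=F(X)/F(A)$ (where $F(A)$ is identified with its image in $F(X)$), with the quotient semi-norm. Put $F^{\mathrm{lf}}(X)=\varprojlim_{K\subset X\text{ compact}}F(X,X\setminus K)$, with the semi-norm $|c|=\inf\lim_K|\overline c_K|\in[0,\infty]$, where the infimum is taken over all families $(\overline c_K)_K$ in $F(X)$ that are Cauchy with respect to $|\cdot|$ and such that $\overline c_K$ represents $c_K$ for all $K$. The natural chain map $C_*\to C_*^\square$, $\sigma\mapsto[\sigma\circ\kappa_n]$,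 with $\kappa_n\colon[0,1]^n\to\Delta^n$, $\kappa_n(x)=(1-x_1,\,x_1(1-x_2),\,\dots,\,x_1\cdots x_{n-1}(1-x_n),\,x_1\cdots x_n)$, induces the canonical isomorphisms between singular and cubical homology (absolute, relative, and locally finite). For an oriented compact $n$-manifold $M$, with possibly empty boundary $\partial M$, let $[M,\partial M]_{\mathbb R}\in H_n(M,\partial M;\mathbb R)$ be its fundamental class and let $[M,\partial M]^\square_{\mathbb R}$ be the corresponding class in cubical homology. The relative simplicial volume $\|M,\partial M\|$ is the infimum of $|c|$ over all relative singular cycles $c\in C_n(M,\partial M;\mathbb R)$ that represent $[M,\partial M]_{\mathbb R}$, and the relative cubical simplicial volume $\|M,\partial M\|^\square$ is the infimum of $|c|$ over all relative cubical cycles $c\in C_n^\square(M,\partial M;\mathbb R)$ that represent $[M,\partial M]_{\mathbb R}^\square$. For an oriented $n$-manifold $N$ without boundary, $\|N\|_{\mathrm{lf}}\in[0,\infty]$ and $\|N\|^\square_{\mathrm{lf}}\in[0,\infty]$ are defined in the same way, through locally finite singular and locally finite cubical cycles that represent the locally finite fundamental class $[N]^{\mathrm{lf}}_{\mathbb R}\in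 H_n^{\mathrm{lf}}(N;\mathbb R)$ and the corresponding cubical class, respectively. **Corollary.** For all oriented compact $3$-manifolds $M$ and for all oriented $3$-manifolds $N$ without boundary we have $$\|M,\partial M\|^\square\;\ge\;\frac15\cdot\|M,\partial M\| \qquad\text{and}\qquad \|N\|^\square_{\mathrm{lf}}\;\ge\;\frac15\cdot\|N\|_{\mathrm{lf}}.$$ -/

import Mathlib

open scoped Manifold ENNReal

namespace CubicalVolume

/-! ### Chain complexes of modules -/

section Algebra

universe v v₁ v₂ w

/-- Chain complexes of `R`-modules, in degrees `0, 1, 2, …`. -/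
structure Cplx (R : Type) [CommRing R] where
  /-- the module of chains of degree `n` -/
  C : ℕ → Type v
  [grp : ∀ n, AddCommGroup (C n)]
  [mod : ∀ n, Module R (C n)]
  /-- the boundary operator -/
  d : ∀ n, C (n + 1) →ₗ[R] C n
  d_d : ∀ n c, d n (d (n + 1) c) = 0

attribute [instance] Cplx.grp Cplx.mod

variable {R S : Type} [CommRing R] [CommRing S] {σ : R →+* S}

namespace Cplx

/-- The cycles of degree `n` (in degree `0` every chain is a cycle). -/
def cycles (K : Cplx.{v} R) : ∀ n, Submodule R (K.C n)
  | 0 => ⊤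
  | n + 1 => LinearMap.ker (K.d n)

/-- Homology: cycles modulo boundaries. -/
abbrev Homology (K : Cplx.{v} R) (n : ℕ) : Type v :=
  K.cycles n ⧸ (LinearMap.range (K.d n)).comap (K.cycles n).subtype

/-- The homology class of a cycle. -/
def homologyClass (K : Cplx.{v} R) {n : ℕ} (z : K.cycles n) : K.Homology n :=
  Submodule.Quotient.mk z

/-- Chain maps, possibly semilinear in order to allow for changes of coefficients. -/
structure Hom (σ : R →+* S) (K : Cplx.{v₁} R) (L : Cplx.{v₂} S) where
  /-- the map in degree `n` -/
  f : ∀ n, K.C n →ₛₗ[σ] L.C n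
  comm : ∀ n c, f n (K.d n c) = L.d n (f (n + 1) c)

theorem Hom.map_mem_cycles {K : Cplx.{v₁} R} {L : Cplx.{v₂} S} (φ : Hom σ K L) (n : ℕ)
    (z : K.cycles n) : φ.f n z ∈ L.cycles n := by
  cases n with
  | zero => trivial
  | succ n =>
    have hz : K.d n z = 0 := z.2
    change L.d n (φ.f (n + 1) z) = 0
    rw [← φ.comm, hz, map_zero]

/-- The map on homology induced by a chain map. -/
def Hom.homology {K : Cplx.{v₁} R} {L : Cplx.{v₂} S} (φ : Hom σ K L) (n : ℕ) :
    K.Homology n →ₛₗ[σ] L.Homology n :=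
  Submodule.mapQ _ _
    (((φ.f n).comp (K.cycles n).subtype).codRestrict (L.cycles n) (φ.map_mem_cycles n))
    (by
      rintro z ⟨b, hb⟩
      refine ⟨φ.f (n + 1) b, ?_⟩
      rw [← φ.comm, hb]
      rfl)

/-- Subcomplexes. -/
structure Sub (K : Cplx.{v} R) where
  /-- the submodule in degree `n` -/
  p : ∀ n, Submodule R (K.C n)
  le : ∀ n, p (n + 1) ≤ (p n).comap (K.d n)

/-- The image of a chain map. -/
def Hom.range {K : Cplx.{v₁} R} {L : Cplx.{v₂} R} (φ : Hom (RingHom.id R) K L) : L.Sub where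
  p n := LinearMap.range (φ.f n)
  le := by
    rintro n _ ⟨c, rfl⟩
    exact ⟨K.d n c, φ.comm n c⟩

/-- The quotient complex. -/
def quot (K : Cplx.{v} R) (P : K.Sub) : Cplx.{v} R where
  C n := K.C n ⧸ P.p n
  d n := Submodule.mapQ _ _ (K.d n) (P.le n)
  d_d n c := by
    obtain ⟨c, rfl⟩ := Submodule.Quotient.mk_surjective _ c
    simp only [Submodule.mapQ_apply, K.d_d, Submodule.Quotient.mk_zero]

/-- The class of a chain in the quotient complex. -/
def quotMk (K : Cplx.{v} R) (P : K.Sub) : Hom (RingHom.id R) K (K.quot P) where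
  f n := (P.p n).mkQ
  comm _ _ := rfl

theorem quotMk_surjective (K : Cplx.{v} R) (P : K.Sub) {n : ℕ} (c : (K.quot P).C n) :
    ∃ b, (K.quotMk P).f n b = c :=
  Submodule.Quotient.mk_surjective _ c

/-- The chain map between quotient complexes induced by a chain map that is compatible with
the given subcomplexes. -/
def Hom.quot {K : Cplx.{v₁} R} {L : Cplx.{v₂} S} (φ : Hom σ K L) (P : K.Sub) (Q : L.Sub)
    (h : ∀ n, P.p n ≤ (Q.p n).comap (φ.f n)) : Hom σ (K.quot P) (L.quot Q) where
  f n := Submodule.mapQ (P.p n) (Q.p n) (φ.f n) (h n)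
  comm n c := by
    obtain ⟨c, rfl⟩ := Submodule.Quotient.mk_surjective _ c
    exact congrArg (Submodule.Quotient.mk (p := Q.p n)) (φ.comm n c)

/-- The projection `K / P → K / Q` for subcomplexes `P ⊆ Q`. -/
def factor (K : Cplx.{v} R) (P Q : K.Sub) (h : ∀ n, P.p n ≤ Q.p n) :
    Hom (RingHom.id R) (K.quot P) (K.quot Q) :=
  Hom.quot (σ := RingHom.id R) ⟨fun _ => LinearMap.id, fun _ _ => rfl⟩ P Q h

/-- The chains of the inverse limit `lim_i K / Q i` for a family of subcomplexes that is antitone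
in the (directed) index `i`: the compatible families of chains of the quotients. -/
def limChains (K : Cplx.{v} R) {ι : Type w} [Preorder ι] (Q : ι → K.Sub)
    (hQ : ∀ i j, i ≤ j → ∀ n, (Q j).p n ≤ (Q i).p n) (n : ℕ) :
    Submodule R (∀ i, (K.quot (Q i)).C n) where
  carrier := {c | ∀ i j (h : i ≤ j), (K.factor (Q j) (Q i) (hQ i j h)).f n (c j) = c i}
  add_mem' := by
    intro a b ha hb i j h
    simp only [Pi.add_apply, map_add, ha i j h, hb i j h]
  zero_mem' := by
    intro i j h
    simp only [Pi.zero_apply, map_zero]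
  smul_mem' := by
    intro r a ha i j h
    simp only [Pi.smul_apply, map_smul, ha i j h]

/-- The inverse limit `lim_i K / Q i`, with the componentwise boundary operator. -/
def lim (K : Cplx.{v} R) {ι : Type w} [Preorder ι] (Q : ι → K.Sub)
    (hQ : ∀ i j, i ≤ j → ∀ n, (Q j).p n ≤ (Q i).p n) : Cplx.{max v w} R where
  C n := K.limChains Q hQ n
  d n := ((LinearMap.pi fun i => ((K.quot (Q i)).d n).comp (LinearMap.proj i)).comp
    (K.limChains Q hQ (n + 1)).subtype).codRestrict _ (fun c i j h => by
      refine ((K.factor (Q j) (Q i) (hQ i j h)).comm n (c.1 j)).trans ?_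
      rw [c.2 i j h]
      rfl)
  d_d n c := Subtype.ext (funext fun i => (K.quot (Q i)).d_d n (c.1 i))

/-- The component at the index `i`. -/
def limEval (K : Cplx.{v} R) {ι : Type w} [Preorder ι] (Q : ι → K.Sub)
    (hQ : ∀ i j, i ≤ j → ∀ n, (Q j).p n ≤ (Q i).p n) (i : ι) :
    Hom (RingHom.id R) (K.lim Q hQ) (K.quot (Q i)) where
  f n := (LinearMap.proj i).comp (K.limChains Q hQ n).subtype
  comm _ _ := rfl

/-- The (componentwise) chain map between inverse limits induced by a chain map. -/
def Hom.lim {K : Cplx.{v₁} R} {L : Cplx.{v₂} R} (φ : Hom (RingHom.id R) K L)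
    {ι : Type w} [Preorder ι] (P : ι → K.Sub) (Q : ι → L.Sub)
    (hP : ∀ i j, i ≤ j → ∀ n, (P j).p n ≤ (P i).p n)
    (hQ : ∀ i j, i ≤ j → ∀ n, (Q j).p n ≤ (Q i).p n)
    (h : ∀ i n, (P i).p n ≤ ((Q i).p n).comap (φ.f n)) :
    Hom (RingHom.id R) (K.lim P hP) (L.lim Q hQ) where
  f n := ((LinearMap.pi fun i => ((φ.quot (P i) (Q i) (h i)).f n).comp (LinearMap.proj i)).comp
    (K.limChains P hP n).subtype).codRestrict _ (fun c i j hij => by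
      obtain ⟨b, hb⟩ := K.quotMk_surjective (P j) (c.1 j)
      change (L.factor (Q j) (Q i) (hQ i j hij)).f n ((φ.quot (P j) (Q j) (h j)).f n (c.1 j)) =
        (φ.quot (P i) (Q i) (h i)).f n (c.1 i)
      rw [← c.2 i j hij, ← hb]
      rfl)
  comm n c := Subtype.ext (funext fun i => (φ.quot (P i) (Q i) (h i)).comm n (c.1 i))

/-! ### Semi-norms, possibly with value `∞` -/

/-- The quotient semi-norm on a quotient complex. -/
noncomputable def quotNorm (K : Cplx.{v} R) (ν : ∀ n, K.C n → ℝ≥0∞) (P : K.Sub) (n : ℕ)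
    (c : (K.quot P).C n) : ℝ≥0∞ :=
  ⨅ (b : K.C n) (_ : (K.quotMk P).f n b = c), ν n b

/-- The semi-norm on an inverse limit `lim_i K / Q i`: the infimum of the limits
`lim_i ν (b i)` over all families `b` of chains of `K` such that `b i` represents the
component `c i` for every `i` and such that `b` is Cauchy with respect to `ν`.
It is `∞` if there is no such family. -/
noncomputable def limNorm (K : Cplx.{v} R) (ν : ∀ n, K.C n → ℝ≥0∞) {ι : Type w} [Preorder ι]
    (Q : ι → K.Sub) (hQ : ∀ i j, i ≤ j → ∀ n, (Q j).p n ≤ (Q i).p n) (n : ℕ)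
    (c : (K.lim Q hQ).C n) : ℝ≥0∞ :=
  ⨅ (b : ι → K.C n) (_ : ∀ i, (K.quotMk (Q i)).f n (b i) = (K.limEval Q hQ i).f n c)
    (_ : ∀ ε : ℝ≥0∞, 0 < ε → ∃ k, ∀ i j, k ≤ i → k ≤ j → ν n (b i - b j) < ε)
    (r : ℝ≥0∞) (_ : Filter.Tendsto (fun i => ν n (b i)) Filter.atTop (nhds r)), r

/-- The semi-norm on homology induced by a semi-norm on chains: the infimum of the semi-norms of
all cycles that represent the given class. -/
noncomputable def homologyNorm (K : Cplx.{v} R) (ν : ∀ n, K.C n → ℝ≥0∞) (n : ℕ)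
    (α : K.Homology n) : ℝ≥0∞ :=
  ⨅ (z : K.cycles n) (_ : K.homologyClass z = α), ν n z

end Cplx

/-- The `ℓ¹`-norm of a finite real linear combination, with respect to the given basis. -/
noncomputable def l1Norm {B : Type v} (c : B →₀ ℝ) : ℝ≥0∞ :=
  c.sum fun _ a => ‖a‖ₑ

theorem alternating_sum_eq_zero {V : Type v} [AddCommGroup V] [Module R V] (n : ℕ)
    (g : Fin (n + 2) → Fin (n + 1) → V)
    (hg : ∀ i j, g (i.succAbove j) (j.predAbove i) = g i j) :
    ∑ i : Fin (n + 2), ∑ j : Fin (n + 1), (-1 : R) ^ ((i : ℕ) + (j : ℕ)) • g i j = 0 := by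
  rw [← Finset.sum_product']
  refine Finset.sum_involution (fun x _ => (x.1.succAbove x.2, x.2.predAbove x.1)) ?_ ?_ ?_ ?_
  · rintro ⟨i, j⟩ -
    simp only [hg, Fin.neg_one_pow_succAbove_add_predAbove, neg_smul, add_neg_cancel]
  · rintro ⟨i, j⟩ - - h
    exact Fin.succAbove_ne i j (congrArg Prod.fst h)
  · intros
    simp
  · rintro ⟨i, j⟩ -
    simp only [Fin.succAbove_succAbove_predAbove, Fin.predAbove_predAbove_succAbove]

theorem insertNth_insertNth {α : Type v} {n : ℕ} (i : Fin (n + 2)) (j : Fin (n + 1)) (a b : α)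
    (x : Fin n → α) :
    (i.insertNth a (j.insertNth b x : Fin (n + 1) → α) : Fin (n + 2) → α) =
      (i.succAbove j).insertNth b ((j.predAbove i).insertNth a x : Fin (n + 1) → α) := by
  rw [Fin.insertNth_eq_iff]
  constructor
  · have h := Fin.insertNth_apply_succAbove (α := fun _ => α) (i.succAbove j) b
      ((j.predAbove i).insertNth a x : Fin (n + 1) → α) (j.predAbove i)
    rw [Fin.succAbove_succAbove_predAbove, Fin.insertNth_apply_same] at h
    exact h.symm
  · rw [Fin.insertNth_eq_iff]
    constructor
    · simp [Fin.removeNth_apply]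
    · funext k
      simp [Fin.removeNth_apply, ← Fin.succAbove_succAbove_succAbove_predAbove i j k]

end Algebra

universe u

/-- The inclusion of a subspace. -/
def incl {X : Type u} [TopologicalSpace X] (A : Set X) : C(A, X) := ⟨Subtype.val, by fun_prop⟩

/-- The inclusion of a subspace into a larger one. -/
def inclOfSubset {X : Type u} [TopologicalSpace X] {A B : Set X} (h : A ⊆ B) : C(A, B) :=
  ⟨Set.inclusion h, continuous_inclusion h⟩

theorem compl_anti {X : Type u} [TopologicalSpace X] (K L : TopologicalSpace.Compacts X)
    (h : K ≤ L) : (L : Set X)ᶜ ⊆ (K : Set X)ᶜ :=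
  Set.compl_subset_compl.mpr h

/-! ### Singular chains -/

section Singular

/-- Singular `n`-simplices. -/
abbrev SingSimplex (n : ℕ) (X : Type u) [TopologicalSpace X] : Type u :=
  C(stdSimplex ℝ (Fin (n + 1)), X)

/-- The `i`-th face `Δⁿ → Δⁿ⁺¹` of the standard simplex, inserting `0` as `i`-th barycentric
coordinate. -/
def simplexFace (n : ℕ) (i : Fin (n + 2)) :
    C(stdSimplex ℝ (Fin (n + 1)), stdSimplex ℝ (Fin (n + 2))) where
  toFun t := ⟨i.insertNth (0 : ℝ) (t : Fin (n + 1) → ℝ), by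
    constructor
    · intro j
      refine Fin.succAboveCases i ?_ (fun k => ?_) j
      · simp
      · simp
    · rw [Fin.sum_univ_succAbove _ i]
      simp⟩
  continuous_toFun := by
    refine Continuous.subtype_mk ?_ _
    exact Continuous.finInsertNth i continuous_const continuous_subtype_val

variable (R : Type) [CommRing R]

/-- Singular `n`-chains of `X` with coefficients in `R`. -/
abbrev SingChain (X : Type u) [TopologicalSpace X] (n : ℕ) : Type u := SingSimplex n X →₀ R

/-- The singular boundary operator `∂τ = ∑ᵢ (-1)ⁱ τ ∘ (i-th face)`. -/
noncomputable def singD (X : Type u) [TopologicalSpace X] (n : ℕ) :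
    SingChain R X (n + 1) →ₗ[R] SingChain R X n :=
  ∑ i : Fin (n + 2), (-1 : R) ^ (i : ℕ) •
    Finsupp.lmapDomain R R (fun τ : SingSimplex (n + 1) X => τ.comp (simplexFace n i))

theorem singD_single {X : Type u} [TopologicalSpace X] (n : ℕ) (τ : SingSimplex (n + 1) X)
    (r : R) : singD R X n (Finsupp.single τ r) =
      ∑ i : Fin (n + 2), (-1 : R) ^ (i : ℕ) • Finsupp.single (τ.comp (simplexFace n i)) r := by
  simp [singD, LinearMap.sum_apply, Finsupp.lmapDomain_apply, Finsupp.mapDomain_single]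

theorem singD_singD {X : Type u} [TopologicalSpace X] (n : ℕ) (c : SingChain R X (n + 2)) :
    singD R X n (singD R X (n + 1) c) = 0 := by
  induction c using Finsupp.induction_linear with
  | zero => simp only [map_zero]
  | add a b ha hb => simp only [map_add, ha, hb, add_zero]
  | single τ r =>
    rw [singD_single, map_sum]
    simp only [map_smul, singD_single, Finset.smul_sum, smul_smul, ← pow_add]
    refine alternating_sum_eq_zero (R := R) (n + 1) (fun i j =>
      Finsupp.single ((τ.comp (simplexFace (n + 1) i)).comp (simplexFace n j)) r) ?_
    intro i j
    refine congrArg (fun s => Finsupp.single s r) (ContinuousMap.ext fun x => ?_)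
    exact congrArg τ (Subtype.ext (insertNth_insertNth i j 0 0 _).symm)

/-- The singular chain complex `C_*(X; R)`. -/
noncomputable def sing (X : Type u) [TopologicalSpace X] : Cplx.{u} R where
  C n := SingChain R X n
  d n := singD R X n
  d_d n c := singD_singD R n c

/-- The chain map on singular chains induced by a continuous map. -/
noncomputable def singMap {X Y : Type u} [TopologicalSpace X] [TopologicalSpace Y] (f : C(X, Y)) :
    Cplx.Hom (RingHom.id R) (sing R X) (sing R Y) where
  f n := Finsupp.lmapDomain R R (fun τ : SingSimplex n X => f.comp τ)
  comm n c := by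
    change SingChain R X (n + 1) at c
    change Finsupp.lmapDomain R R _ (singD R X n c) = singD R Y n (Finsupp.lmapDomain R R _ c)
    induction c using Finsupp.induction_linear with
    | zero => simp only [map_zero]
    | add a b ha hb => simp only [map_add, ha, hb]
    | single τ r =>
      simp only [singD_single, Finsupp.lmapDomain_apply, Finsupp.mapDomain_single,
        map_sum, map_smul]
      rfl

/-- The subcomplex `C_*(A; R)` of `C_*(X; R)` of chains in the subspace `A`. -/
noncomputable def singSub {X : Type u} [TopologicalSpace X] (A : Set X) : (sing R X).Sub :=
  (singMap R (incl A)).range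

theorem singSub_mono {X : Type u} [TopologicalSpace X] {A B : Set X} (h : A ⊆ B) (n : ℕ) :
    (singSub R A).p n ≤ (singSub R B).p n := by
  rintro _ ⟨c, rfl⟩
  exact ⟨(singMap R (inclOfSubset h)).f n c, (Finsupp.mapDomain_comp (v := c)).symm⟩

/-- Relative singular chains `C_*(X, A; R) = C_*(X; R) / C_*(A; R)`. -/
noncomputable def singRel {X : Type u} [TopologicalSpace X] (A : Set X) : Cplx.{u} R :=
  (sing R X).quot (singSub R A)

/-- The chain map `C_*(X, A; R) → C_*(X, B; R)` induced by the identity map of `X`, for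
`A ⊆ B`. -/
noncomputable def singRelFactor {X : Type u} [TopologicalSpace X] {A B : Set X} (h : A ⊆ B) :
    Cplx.Hom (RingHom.id R) (singRel R A) (singRel R B) :=
  (sing R X).factor (singSub R A) (singSub R B) (singSub_mono R h)

/-- The subcomplexes `C_*(X ∖ K; R)` of `C_*(X; R)`, for `K` compact. -/
noncomputable def singFar (X : Type u) [TopologicalSpace X] (K : TopologicalSpace.Compacts X) :
    (sing R X).Sub :=
  singSub R (K : Set X)ᶜ

theorem singFar_anti (X : Type u) [TopologicalSpace X] (K L : TopologicalSpace.Compacts X)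
    (h : K ≤ L) (n : ℕ) : (singFar R X L).p n ≤ (singFar R X K).p n :=
  singSub_mono R (compl_anti K L h) n

/-- Locally finite singular chains: `C_*^lf(X; R) = lim_K C_*(X, X ∖ K; R)`, where `K` runs
through the directed set of all compact subsets of `X`. -/
noncomputable def singLf (X : Type u) [TopologicalSpace X] : Cplx.{u} R :=
  (sing R X).lim (singFar R X) (singFar_anti R X)

/-- The restriction `C_*^lf(X; R) → C_*(X, X ∖ K; R)` to a compact subset `K`. -/
noncomputable def singLfRestrict {X : Type u} [TopologicalSpace X]
    (K : TopologicalSpace.Compacts X) :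
    Cplx.Hom (RingHom.id R) (singLf R X) (singRel R (K : Set X)ᶜ) :=
  (sing R X).limEval (singFar R X) (singFar_anti R X) K

end Singular

section Coefficients

/-- The change of coefficients `C_*(X; ℤ) → C_*(X; ℝ)`. -/
noncomputable def singCoeff (X : Type u) [TopologicalSpace X] :
    Cplx.Hom (Int.castRingHom ℝ) (sing ℤ X) (sing ℝ X) where
  f n := Finsupp.mapRange.linearMap (α := SingSimplex n X) (Int.castRingHom ℝ).toSemilinearMap
  comm n c := by
    change SingChain ℤ X (n + 1) at c
    change Finsupp.mapRange.linearMap _ (singD ℤ X n c) =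
      singD ℝ X n (Finsupp.mapRange.linearMap _ c)
    induction c using Finsupp.induction_linear with
    | zero => simp only [map_zero]
    | add a b ha hb => simp only [map_add, ha, hb]
    | single τ r =>
      simp only [singD_single, map_sum, Finsupp.mapRange.linearMap_apply,
        Finsupp.mapRange_single, Finsupp.smul_single, smul_eq_mul]
      simp

theorem singCoeff_sub {X : Type u} [TopologicalSpace X] (A : Set X) (n : ℕ) :
    (singSub ℤ A).p n ≤ ((singSub ℝ A).p n).comap ((singCoeff X).f n) := by
  rintro _ ⟨c, rfl⟩
  refine ⟨(singCoeff A).f n c, ?_⟩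
  change SingChain ℤ A n at c
  change Finsupp.lmapDomain ℝ ℝ _ (Finsupp.mapRange.linearMap _ c) =
    Finsupp.mapRange.linearMap _ (Finsupp.lmapDomain ℤ ℤ _ c)
  induction c using Finsupp.induction_linear with
  | zero => simp only [map_zero]
  | add a b ha hb => simp only [map_add, ha, hb]
  | single τ r =>
    simp only [Finsupp.lmapDomain_apply, Finsupp.mapDomain_single,
      Finsupp.mapRange.linearMap_apply, Finsupp.mapRange_single]

/-- The change of coefficients `C_*(X, A; ℤ) → C_*(X, A; ℝ)`. -/
noncomputable def singRelCoeff {X : Type u} [TopologicalSpace X] (A : Set X) :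
    Cplx.Hom (Int.castRingHom ℝ) (singRel ℤ A) (singRel ℝ A) :=
  (singCoeff X).quot (singSub ℤ A) (singSub ℝ A) (singCoeff_sub A)

end Coefficients

/-! ### Cubical chains -/

section Cubical

/-- Singular `n`-cubes. -/
abbrev SingCube (n : ℕ) (X : Type u) [TopologicalSpace X] : Type u :=
  C(Fin n → unitInterval, X)

/-- The `(j, i)`-face of the standard `(n + 1)`-cube, inserting `i` as `j`-th coordinate. -/
def cubeFace (n : ℕ) (j : Fin (n + 1)) (i : unitInterval) :
    C(Fin n → unitInterval, Fin (n + 1) → unitInterval) where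
  toFun x := j.insertNth i x
  continuous_toFun := Continuous.finInsertNth j continuous_const continuous_id

/-- A singular cube is degenerate if it is independent of one of the coordinates. -/
def IsDegenerate {n : ℕ} {X : Type u} [TopologicalSpace X] (c : SingCube n X) : Prop :=
  ∃ j : Fin n, ∀ (x : Fin n → unitInterval) (t : unitInterval), c (Function.update x j t) = c x

/-- Real linear combinations of all singular `n`-cubes. -/
abbrev CubeChain (X : Type u) [TopologicalSpace X] (n : ℕ) : Type u := SingCube n X →₀ ℝ

/-- The cubical boundary operator. With coordinates numbered from `0`, this is
`∂c = ∑ⱼ (-1)ʲ⁺¹ (c ∘ (j, 0)-face - c ∘ (j, 1)-face)`. -/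
noncomputable def cubeD (X : Type u) [TopologicalSpace X] (n : ℕ) :
    CubeChain X (n + 1) →ₗ[ℝ] CubeChain X n :=
  ∑ j : Fin (n + 1), (-1 : ℝ) ^ ((j : ℕ) + 1) •
    (Finsupp.lmapDomain ℝ ℝ (fun c : SingCube (n + 1) X => c.comp (cubeFace n j 0)) -
      Finsupp.lmapDomain ℝ ℝ (fun c : SingCube (n + 1) X => c.comp (cubeFace n j 1)))

theorem cubeD_single {X : Type u} [TopologicalSpace X] (n : ℕ) (c : SingCube (n + 1) X) (r : ℝ) :
    cubeD X n (Finsupp.single c r) = ∑ j : Fin (n + 1), (-1 : ℝ) ^ ((j : ℕ) + 1) •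
      (Finsupp.single (c.comp (cubeFace n j 0)) r -
        Finsupp.single (c.comp (cubeFace n j 1)) r) := by
  simp [cubeD, LinearMap.sum_apply, Finsupp.lmapDomain_apply, Finsupp.mapDomain_single]

theorem cubeD_cubeD {X : Type u} [TopologicalSpace X] (n : ℕ) (c : CubeChain X (n + 2)) :
    cubeD X n (cubeD X (n + 1) c) = 0 := by
  induction c using Finsupp.induction_linear with
  | zero => simp only [map_zero]
  | add a b ha hb => simp only [map_add, ha, hb, add_zero]
  | single τ r =>
    have hface : ∀ (i : Fin (n + 2)) (j : Fin (n + 1)) (a b : unitInterval),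
        (τ.comp (cubeFace (n + 1) i a)).comp (cubeFace n j b) =
          (τ.comp (cubeFace (n + 1) (i.succAbove j) b)).comp (cubeFace n (j.predAbove i) a) :=
      fun i j a b => ContinuousMap.ext fun x => congrArg τ (insertNth_insertNth i j a b x)
    let s : Fin (n + 2) → Fin (n + 1) → unitInterval → unitInterval → CubeChain X n :=
      fun i j a b => Finsupp.single ((τ.comp (cubeFace (n + 1) i a)).comp (cubeFace n j b)) r
    have h := alternating_sum_eq_zero (R := ℝ) n
      (fun i j => s i j 0 0 - s i j 0 1 - (s i j 1 0 - s i j 1 1)) (by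
        intro i j
        simp only [s, ← hface i j]
        abel)
    rw [← h, cubeD_single, map_sum]
    refine Finset.sum_congr rfl fun i _ => ?_
    rw [map_smul, map_sub, cubeD_single, cubeD_single, ← Finset.sum_sub_distrib, Finset.smul_sum]
    refine Finset.sum_congr rfl fun j _ => ?_
    rw [← smul_sub, smul_smul]
    congr 1
    ring

/-- The complex `Q_*(X; ℝ)` of all cubical singular chains. -/
noncomputable def cube (X : Type u) [TopologicalSpace X] : Cplx.{u} ℝ where
  C n := CubeChain X n
  d n := cubeD X n
  d_d n c := cubeD_cubeD n c

/-- The chain map on `Q_*` induced by a continuous map. -/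
noncomputable def cubeMap {X Y : Type u} [TopologicalSpace X] [TopologicalSpace Y] (f : C(X, Y)) :
    Cplx.Hom (RingHom.id ℝ) (cube X) (cube Y) where
  f n := Finsupp.lmapDomain ℝ ℝ (fun c : SingCube n X => f.comp c)
  comm n c := by
    change CubeChain X (n + 1) at c
    change Finsupp.lmapDomain ℝ ℝ _ (cubeD X n c) = cubeD Y n (Finsupp.lmapDomain ℝ ℝ _ c)
    induction c using Finsupp.induction_linear with
    | zero => simp only [map_zero]
    | add a b ha hb => simp only [map_add, ha, hb]
    | single τ r =>
      simp only [cubeD_single, Finsupp.lmapDomain_apply, Finsupp.mapDomain_single, map_sum,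
        map_smul, map_sub]
      rfl

/-- The submodule generated by the degenerate cubes. -/
noncomputable def degenerate (X : Type u) [TopologicalSpace X] (n : ℕ) :
    Submodule ℝ (CubeChain X n) :=
  Submodule.span ℝ {q | ∃ c : SingCube n X, IsDegenerate c ∧ q = Finsupp.single c 1}

theorem single_mem_degenerate {X : Type u} [TopologicalSpace X] {n : ℕ} {c : SingCube n X}
    (hc : IsDegenerate c) (r : ℝ) : Finsupp.single c r ∈ degenerate X n := by
  have h := (degenerate X n).smul_mem r (Submodule.subset_span ⟨c, hc, rfl⟩)
  simpa using h

theorem degenerate_le (X : Type u) [TopologicalSpace X] (n : ℕ) :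
    degenerate X (n + 1) ≤ (degenerate X n).comap (cubeD X n) := by
  refine Submodule.span_le.mpr ?_
  rintro _ ⟨c, ⟨j, hj⟩, rfl⟩
  change cubeD X n _ ∈ degenerate X n
  rw [cubeD_single]
  refine Submodule.sum_mem _ fun k _ => Submodule.smul_mem _ _ ?_
  rcases eq_or_ne j k with rfl | hjk
  · have : c.comp (cubeFace n j 0) = c.comp (cubeFace n j 1) := by
      ext x
      change c (j.insertNth 0 x) = c (j.insertNth 1 x)
      rw [← hj (j.insertNth 0 x) 1, Fin.update_insertNth]
    rw [this, sub_self]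
    exact Submodule.zero_mem _
  · obtain ⟨l, rfl⟩ := Fin.exists_succAbove_eq hjk
    have key : ∀ i : unitInterval, IsDegenerate (c.comp (cubeFace n k i)) := by
      intro i
      refine ⟨l, fun x t => ?_⟩
      change c (k.insertNth i (Function.update x l t)) = c (k.insertNth i x)
      rw [Fin.insertNth_update, hj]
    exact Submodule.sub_mem _ (single_mem_degenerate (key 0) 1)
      (single_mem_degenerate (key 1) 1)

/-- The subcomplex `D_*(X; ℝ)` of `Q_*(X; ℝ)` generated by the degenerate cubes. -/
noncomputable def degSub (X : Type u) [TopologicalSpace X] : (cube X).Sub where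
  p n := degenerate X n
  le n := degenerate_le X n

/-- The cubical chain complex `C_*^□(X; ℝ) = Q_*(X; ℝ) / D_*(X; ℝ)`. -/
noncomputable def cub (X : Type u) [TopologicalSpace X] : Cplx.{u} ℝ :=
  (cube X).quot (degSub X)

/-- The norm on `C_*^□(X; ℝ)` induced by the `ℓ¹`-norm on `Q_*(X; ℝ)` with respect to the basis
of all singular cubes. -/
noncomputable def cubNorm (X : Type u) [TopologicalSpace X] : ∀ n, (cub X).C n → ℝ≥0∞ :=
  (cube X).quotNorm (fun n (c : CubeChain X n) => l1Norm c) (degSub X)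

theorem degSub_map {X Y : Type u} [TopologicalSpace X] [TopologicalSpace Y] (f : C(X, Y))
    (n : ℕ) : (degSub X).p n ≤ ((degSub Y).p n).comap ((cubeMap f).f n) := by
  refine Submodule.span_le.mpr ?_
  rintro _ ⟨c, ⟨j, hj⟩, rfl⟩
  change Finsupp.mapDomain _ _ ∈ degenerate Y n
  rw [Finsupp.mapDomain_single]
  exact single_mem_degenerate ⟨j, fun x t => congrArg f (hj x t)⟩ 1

/-- The chain map on cubical chains induced by a continuous map. -/
noncomputable def cubMap {X Y : Type u} [TopologicalSpace X] [TopologicalSpace Y] (f : C(X, Y)) :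
    Cplx.Hom (RingHom.id ℝ) (cub X) (cub Y) :=
  (cubeMap f).quot (degSub X) (degSub Y) (degSub_map f)

/-- The image of `C_*^□(A; ℝ)` in `C_*^□(X; ℝ)`, for a subspace `A`. -/
noncomputable def cubSub {X : Type u} [TopologicalSpace X] (A : Set X) : (cub X).Sub :=
  (cubMap (incl A)).range

theorem cubSub_mono {X : Type u} [TopologicalSpace X] {A B : Set X} (h : A ⊆ B) (n : ℕ) :
    (cubSub A).p n ≤ (cubSub B).p n := by
  rintro _ ⟨c, rfl⟩
  refine ⟨(cubMap (inclOfSubset h)).f n c, ?_⟩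
  obtain ⟨c, rfl⟩ := Cplx.quotMk_surjective _ _ c
  exact congrArg ((cube X).quotMk (degSub X) |>.f n) (Finsupp.mapDomain_comp (v := c)).symm

/-- Relative cubical chains `C_*^□(X, A; ℝ) = C_*^□(X; ℝ) / C_*^□(A; ℝ)`. -/
noncomputable def cubRel {X : Type u} [TopologicalSpace X] (A : Set X) : Cplx.{u} ℝ :=
  (cub X).quot (cubSub A)

/-- The images of `C_*^□(X ∖ K; ℝ)` in `C_*^□(X; ℝ)`, for `K` compact. -/
noncomputable def cubFar (X : Type u) [TopologicalSpace X] (K : TopologicalSpace.Compacts X) :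
    (cub X).Sub :=
  cubSub (K : Set X)ᶜ

theorem cubFar_anti (X : Type u) [TopologicalSpace X] (K L : TopologicalSpace.Compacts X)
    (h : K ≤ L) (n : ℕ) : (cubFar X L).p n ≤ (cubFar X K).p n :=
  cubSub_mono (compl_anti K L h) n

/-- Locally finite cubical chains: `lim_K C_*^□(X, X ∖ K; ℝ)`, where `K` runs through the
directed set of all compact subsets of `X`. -/
noncomputable def cubLf (X : Type u) [TopologicalSpace X] : Cplx.{u} ℝ :=
  (cub X).lim (cubFar X) (cubFar_anti X)

end Cubical

/-! ### The canonical comparison map from singular to cubical homology -/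

section Comparison

/-- The barycentric coordinates of the standard collapse `□ⁿ → Δⁿ`,
`(x₁, …, xₙ) ↦ (1 - x₁, x₁ (1 - x₂), x₁ x₂ (1 - x₃), …, x₁ ⋯ xₙ₋₁ (1 - xₙ), x₁ ⋯ xₙ)`. -/
def collapseFun : ∀ n : ℕ, (Fin n → unitInterval) → Fin (n + 1) → ℝ
  | 0, _ => fun _ => 1
  | n + 1, x => Fin.cons (1 - (x 0 : ℝ)) fun i => (x 0 : ℝ) * collapseFun n (Fin.tail x) i

theorem collapseFun_mem : ∀ (n : ℕ) (x : Fin n → unitInterval),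
    collapseFun n x ∈ stdSimplex ℝ (Fin (n + 1))
  | 0, x => by simp [collapseFun, stdSimplex]
  | n + 1, x => by
    obtain ⟨h0, h1⟩ := collapseFun_mem n (Fin.tail x)
    constructor
    · intro i
      refine Fin.cases ?_ (fun k => ?_) i
      · simpa [collapseFun] using (x 0).2.2
      · simpa [collapseFun] using mul_nonneg (x 0).2.1 (h0 k)
    · rw [Fin.sum_univ_succ]
      simp [collapseFun, ← Finset.mul_sum, h1]

theorem continuous_collapseFun : ∀ n : ℕ, Continuous (collapseFun n)
  | 0 => continuous_const
  | n + 1 => by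
    have h := continuous_collapseFun n
    refine continuous_pi fun i => ?_
    refine Fin.cases ?_ (fun k => ?_) i
    · simp only [collapseFun, Fin.cons_zero]
      fun_prop
    · simp only [collapseFun, Fin.cons_succ]
      have h2 : Continuous fun x : Fin (n + 1) → unitInterval => collapseFun n (Fin.tail x) k :=
        (continuous_apply k).comp (h.comp (by unfold Fin.tail; fun_prop))
      fun_prop

/-- The standard collapse `□ⁿ → Δⁿ`. -/
def collapse (n : ℕ) : C(Fin n → unitInterval, stdSimplex ℝ (Fin (n + 1))) where
  toFun x := ⟨collapseFun n x, collapseFun_mem n x⟩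
  continuous_toFun := (continuous_collapseFun n).subtype_mk _

theorem collapseFun_cons (n : ℕ) (a : unitInterval) (x : Fin n → unitInterval) :
    collapseFun (n + 1) (Fin.cons a x : Fin (n + 1) → unitInterval) =
      (Fin.cons (1 - (a : ℝ)) fun i => (a : ℝ) * collapseFun n x i : Fin (n + 2) → ℝ) := by
  simp [collapseFun]

theorem mul_insertNth (n : ℕ) (r : ℝ) (j : Fin (n + 1)) (t : Fin n → ℝ) :
    (fun i => r * (j.insertNth (0 : ℝ) t : Fin (n + 1) → ℝ) i) =
      (j.insertNth (0 : ℝ) (fun i => r * t i) : Fin (n + 1) → ℝ) := by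
  funext k
  refine Fin.succAboveCases j ?_ (fun l => ?_) k <;> simp

theorem collapseFun_one : ∀ (n : ℕ) (j : Fin (n + 1)) (x : Fin n → unitInterval),
    collapseFun (n + 1) (j.insertNth 1 x) = j.castSucc.insertNth (0 : ℝ) (collapseFun n x)
  | n, j, x => by
    induction n with
    | zero =>
      obtain rfl : j = 0 := Fin.fin_one_eq_zero j
      rw [Fin.insertNth_zero', collapseFun_cons]
      simp
    | succ n ih =>
      refine Fin.cases ?_ (fun l => ?_) j
      · rw [Fin.insertNth_zero', collapseFun_cons]
        simp
      · obtain ⟨a, y, rfl⟩ : ∃ (a : unitInterval) (y : Fin n → unitInterval),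
          x = (Fin.cons a y : Fin (n + 1) → unitInterval) := ⟨x 0, Fin.tail x, by simp⟩
        rw [Fin.insertNth_succ_cons, collapseFun_cons, ih, collapseFun_cons, mul_insertNth,
          ← Fin.succ_castSucc, Fin.insertNth_succ_cons]

theorem collapseFun_zero_last : ∀ (n : ℕ) (x : Fin n → unitInterval),
    collapseFun (n + 1) ((Fin.last n).insertNth 0 x) =
      (Fin.last (n + 1)).insertNth (0 : ℝ) (collapseFun n x)
  | n, x => by
    induction n with
    | zero =>
      rw [show Fin.last 0 = 0 from rfl, Fin.insertNth_zero', collapseFun_cons]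
      funext k
      fin_cases k
      · simpa [collapseFun] using (Fin.insertNth_apply_succAbove (α := fun _ => ℝ)
          (1 : Fin 2) 0 (fun _ => 1) 0).symm
      · simp [collapseFun]
    | succ n ih =>
      obtain ⟨a, y, rfl⟩ : ∃ (a : unitInterval) (y : Fin n → unitInterval),
        x = (Fin.cons a y : Fin (n + 1) → unitInterval) := ⟨x 0, Fin.tail x, by simp⟩
      rw [← Fin.succ_last, Fin.insertNth_succ_cons, collapseFun_cons, ih, collapseFun_cons,
        mul_insertNth, ← Fin.succ_last (n + 1), Fin.insertNth_succ_cons]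

theorem collapseFun_zero_castSucc : ∀ (n : ℕ) (j : Fin n) (x : Fin n → unitInterval)
    (t : unitInterval), collapseFun (n + 1) (j.castSucc.insertNth 0 (Function.update x j t)) =
      collapseFun (n + 1) (j.castSucc.insertNth 0 x)
  | n, j, x, t => by
    induction n with
    | zero => exact j.elim0
    | succ n ih =>
      obtain ⟨a, y, rfl⟩ : ∃ (a : unitInterval) (y : Fin n → unitInterval),
        x = (Fin.cons a y : Fin (n + 1) → unitInterval) := ⟨x 0, Fin.tail x, by simp⟩
      refine Fin.cases ?_ (fun l => ?_) j
      · rw [Fin.castSucc_zero, Fin.insertNth_zero', Fin.insertNth_zero', collapseFun_cons,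
          collapseFun_cons]
        simp
      · rw [← Fin.cons_update, ← Fin.succ_castSucc, Fin.insertNth_succ_cons,
          Fin.insertNth_succ_cons, collapseFun_cons, collapseFun_cons, ih]

/-- The map sending a singular simplex `τ` to the class of the singular cube `τ ∘ collapse`. -/
noncomputable def singToCubFun (X : Type u) [TopologicalSpace X] (n : ℕ) :
    SingChain ℝ X n →ₗ[ℝ] (CubeChain X n ⧸ degenerate X n) :=
  (degenerate X n).mkQ.comp
    (Finsupp.lmapDomain ℝ ℝ (fun τ : SingSimplex n X => τ.comp (collapse n)))

theorem singToCubFun_single {X : Type u} [TopologicalSpace X] (n : ℕ) (τ : SingSimplex n X)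
    (r : ℝ) : singToCubFun X n (Finsupp.single τ r) =
      (degenerate X n).mkQ (Finsupp.single (τ.comp (collapse n)) r) := by
  simp [singToCubFun, Finsupp.lmapDomain_apply, Finsupp.mapDomain_single]

theorem singToCubFun_comm {X : Type u} [TopologicalSpace X] (n : ℕ) (c : SingChain ℝ X (n + 1)) :
    singToCubFun X n (singD ℝ X n c) = (degenerate X (n + 1)).mapQ (degenerate X n) (cubeD X n)
      (degenerate_le X n) (singToCubFun X (n + 1) c) := by
  induction c using Finsupp.induction_linear with
  | zero => simp only [map_zero]
  | add a b ha hb => simp only [map_add, ha, hb]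
  | single τ r =>
    have h1 : ∀ j : Fin (n + 1), (τ.comp (collapse (n + 1))).comp (cubeFace n j 1) =
        (τ.comp (simplexFace n j.castSucc)).comp (collapse n) := fun j =>
      ContinuousMap.ext fun x => congrArg τ (Subtype.ext (collapseFun_one n j x))
    have h0 : (τ.comp (collapse (n + 1))).comp (cubeFace n (Fin.last n) 0) =
        (τ.comp (simplexFace n (Fin.last (n + 1)))).comp (collapse n) :=
      ContinuousMap.ext fun x => congrArg τ (Subtype.ext (collapseFun_zero_last n x))
    have hd : ∀ j : Fin n, (degenerate X n).mkQ
        (Finsupp.single ((τ.comp (collapse (n + 1))).comp (cubeFace n j.castSucc 0)) r) = 0 := by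
      intro j
      refine (Submodule.Quotient.mk_eq_zero _).mpr (single_mem_degenerate ⟨j, fun x t => ?_⟩ r)
      exact congrArg τ (Subtype.ext (collapseFun_zero_castSucc n j x t))
    have hR : (degenerate X (n + 1)).mapQ (degenerate X n) (cubeD X n)
        (degenerate_le X n) (singToCubFun X (n + 1) (Finsupp.single τ r)) =
        (degenerate X n).mkQ (cubeD X n (Finsupp.single (τ.comp (collapse (n + 1))) r)) := by
      rw [singToCubFun_single]
      rfl
    rw [hR, singD_single, cubeD_single]
    simp only [map_sum, map_smul, map_sub, singToCubFun_single, smul_sub, Finset.sum_sub_distrib]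
    rw [Fin.sum_univ_castSucc, Fin.sum_univ_castSucc (n := n)
      (f := fun j => (-1 : ℝ) ^ ((j : ℕ) + 1) • (degenerate X n).mkQ
        (Finsupp.single ((τ.comp (collapse (n + 1))).comp (cubeFace n j 0)) r))]
    simp only [hd, smul_zero, Finset.sum_const_zero, zero_add, h0, h1, Fin.val_last,
      Fin.val_castSucc, pow_succ, mul_neg_one, neg_smul, Finset.sum_neg_distrib]
    abel

/-- The canonical natural chain map `C_*(X; ℝ) → C_*^□(X; ℝ)`, sending a singular simplex `τ` to
the class of the singular cube `τ ∘ collapse`. In degree `0` it is the identification of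
`0`-simplices with `0`-cubes, and it induces the canonical isomorphism between singular and
cubical homology. -/
noncomputable def singToCub (X : Type u) [TopologicalSpace X] :
    Cplx.Hom (RingHom.id ℝ) (sing ℝ X) (cub X) where
  f n := singToCubFun X n
  comm n c := singToCubFun_comm n c

theorem singToCub_sub {X : Type u} [TopologicalSpace X] (A : Set X) (n : ℕ) :
    (singSub ℝ A).p n ≤ ((cubSub A).p n).comap ((singToCub X).f n) := by
  rintro _ ⟨c, rfl⟩
  refine ⟨(singToCub A).f n c, ?_⟩
  refine congrArg (degenerate X n).mkQ ?_
  change SingChain ℝ A n at c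
  change Finsupp.mapDomain _ (Finsupp.mapDomain _ c) = Finsupp.mapDomain _ (Finsupp.mapDomain _ c)
  rw [← Finsupp.mapDomain_comp, ← Finsupp.mapDomain_comp]
  rfl

/-- The comparison map on relative chains. -/
noncomputable def singToCubRel {X : Type u} [TopologicalSpace X] (A : Set X) :
    Cplx.Hom (RingHom.id ℝ) (singRel ℝ A) (cubRel A) :=
  (singToCub X).quot (singSub ℝ A) (cubSub A) (singToCub_sub A)

/-- The comparison map on locally finite chains. -/
noncomputable def singToCubLf (X : Type u) [TopologicalSpace X] :
    Cplx.Hom (RingHom.id ℝ) (singLf ℝ X) (cubLf X) :=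
  (singToCub X).lim (singFar ℝ X) (cubFar X) (singFar_anti ℝ X) (cubFar_anti X)
    (fun K => singToCub_sub (K : Set X)ᶜ)

end Comparison

/-! ### Orientations, fundamental classes, simplicial volumes -/

/-- An orientation of an `n`-dimensional topological manifold `M` with boundary `B`: a choice,
for every point `x` outside `B`, of a generator of `H_n(M, M ∖ {x}; ℤ)` (which is infinite
cyclic) that is locally consistent, i.e., every `x` has an open neighbourhood `U` in `M ∖ B`
such that the generators at all points of `U` are restrictions of a single class in
`H_n(M, M ∖ U; ℤ)`. -/
structure Orientation (n : ℕ) (M : Type u) [TopologicalSpace M] (B : Set M) where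
  /-- the local orientation at a point -/
  loc : ∀ x : M, x ∉ B → (singRel ℤ ({x}ᶜ : Set M)).Homology n
  generator : ∀ (x : M) (hx : x ∉ B), Submodule.span ℤ {loc x hx} = ⊤
  consistent : ∀ x : M, x ∉ B → ∃ (U : Set M) (hUB : ∀ y ∈ U, y ∉ B), IsOpen U ∧ x ∈ U ∧
    ∃ μ : (singRel ℤ Uᶜ).Homology n, ∀ (y : M) (hy : y ∈ U),
      (singRelFactor ℤ (Set.compl_subset_compl.mpr (Set.singleton_subset_iff.mpr hy))).homology
        n μ = loc y (hUB y hy)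

/-- A class in `H_n(M, B; ℝ)` is the (real) fundamental class of the oriented compact manifold
`M` with boundary `B` if it restricts to the given local orientation at every point outside
the boundary. There is exactly one such class. -/
def IsFundamentalClass {n : ℕ} {M : Type u} [TopologicalSpace M] {B : Set M}
    (o : Orientation n M B) (α : (singRel ℝ B).Homology n) : Prop :=
  ∀ (x : M) (hx : x ∉ B),
    (singRelFactor ℝ (Set.subset_compl_singleton_iff.mpr hx)).homology n α =
      (singRelCoeff ({x}ᶜ : Set M)).homology n (o.loc x hx)

/-- A class in `H_n^lf(M; ℝ)` is the (real) locally finite fundamental class of the oriented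
manifold `M` without boundary if it restricts to the given local orientation at every point.
There is exactly one such class. -/
def IsLfFundamentalClass {n : ℕ} {M : Type u} [TopologicalSpace M]
    (o : Orientation n M (∅ : Set M)) (α : (singLf ℝ M).Homology n) : Prop :=
  ∀ x : M, (singLfRestrict ℝ ({x} : TopologicalSpace.Compacts M)).homology n α =
    (singRelCoeff ({x}ᶜ : Set M)).homology n (o.loc x (Set.notMem_empty x))

/-- The `ℓ¹`-norm on `C_*(X; ℝ)` with respect to the basis of singular simplices. -/
noncomputable def singNorm (X : Type u) [TopologicalSpace X] : ∀ n, (sing ℝ X).C n → ℝ≥0∞ :=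
  fun n (c : SingChain ℝ X n) => l1Norm c

/-- The relative simplicial volume `‖M, ∂M‖` of an oriented compact `n`-manifold `M` with
boundary `∂M = B`: the semi-norm of its fundamental class. -/
noncomputable def simplicialVolume {n : ℕ} {M : Type u} [TopologicalSpace M] {B : Set M}
    (o : Orientation n M B) : ℝ≥0∞ :=
  ⨅ (α : (singRel ℝ B).Homology n) (_ : IsFundamentalClass o α),
    (singRel ℝ B).homologyNorm ((sing ℝ M).quotNorm (singNorm M) (singSub ℝ B)) n α

/-- The relative cubical simplicial volume `‖M, ∂M‖^□` of an oriented compact `n`-manifold `M`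
with boundary `∂M = B`: the semi-norm of its cubical fundamental class, i.e., of the class in
cubical homology that corresponds to the fundamental class. -/
noncomputable def cubicalSimplicialVolume {n : ℕ} {M : Type u} [TopologicalSpace M] {B : Set M}
    (o : Orientation n M B) : ℝ≥0∞ :=
  ⨅ (α : (singRel ℝ B).Homology n) (_ : IsFundamentalClass o α),
    (cubRel B).homologyNorm ((cub M).quotNorm (cubNorm M) (cubSub B)) n
      ((singToCubRel B).homology n α)

/-- The locally finite simplicial volume `‖M‖^lf ∈ [0, ∞]` of an oriented `n`-manifold without
boundary. -/
noncomputable def lfSimplicialVolume {n : ℕ} {M : Type u} [TopologicalSpace M]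
    (o : Orientation n M (∅ : Set M)) : ℝ≥0∞ :=
  ⨅ (α : (singLf ℝ M).Homology n) (_ : IsLfFundamentalClass o α),
    (singLf ℝ M).homologyNorm
      ((sing ℝ M).limNorm (singNorm M) (singFar ℝ M) (singFar_anti ℝ M)) n α

/-- The locally finite cubical simplicial volume `‖M‖^{□,lf} ∈ [0, ∞]` of an oriented
`n`-manifold without boundary. -/
noncomputable def lfCubicalSimplicialVolume {n : ℕ} {M : Type u} [TopologicalSpace M]
    (o : Orientation n M (∅ : Set M)) : ℝ≥0∞ :=
  ⨅ (α : (singLf ℝ M).Homology n) (_ : IsLfFundamentalClass o α),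
    (cubLf M).homologyNorm
      ((cub M).limNorm (cubNorm M) (cubFar M) (cubFar_anti M)) n ((singToCubLf M).homology n α)

end CubicalVolume

/-!
The bound holds for every homology class: each cubical cycle that represents the image of a
singular class `α` can be turned into a singular cycle that represents `α` and whose `ℓ¹`-norm is
at most five times as large. No property of manifolds or of fundamental classes is needed.

The conversion is a natural chain map `cubToSing` from cubical to singular chains. It is the
composition of two steps.

* Antisymmetrization `antisymm`: a singular cube `c` is replaced by the signed average of the cubes
  `c ∘ ρ`, where `ρ` runs through the `2ⁿ` compositions of coordinate reflections. This is a chain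
  map of norm at most one. It vanishes on degenerate cubes, and hence it lifts the quotient
  by the degenerate cubes to honest linear combinations of cubes.
* Triangulation `triangulate`: the cube can be triangulated with five tetrahedra (rather than the
  six of the standard triangulation) in two ways. Neither of them is compatible with the faces, as
  opposite faces are cut along different diagonals. But each face is cut along both of its
  diagonals if both triangulations are taken into account. So the average of these two
  triangulations in dimension three and the average of the two triangulations of the square in
  dimension two are parts of a chain map (`singD_threeCube`), which can be extended to higher
  dimensions by coning off, since cubes are contractible. In dimension three its norm is at most
  five (`l1Norm_threeCubeChain_le`).

The composition of the comparison map `singToCub` with `cubToSing` is the identity in degree zero,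
so the method of acyclic models, with the cone construction in simplices, gives a natural chain
homotopy to the identity (`singToCubInverse`). Because of naturality, chain map and homotopy descend
to relative chains and to the inverse limit of locally finite chains. The estimate on the semi-norms
passes to quotients, and to inverse limits as a bounded operator preserves Cauchy families.
-/

namespace CubicalVolume

universe v v₁ v₂ w

/-! ### Homotopy left inverses and semi-norms -/

namespace Cplx

variable {R : Type} [CommRing R]

/-- The composition of two linear chain maps. -/
def Hom.comp {K : Cplx.{v} R} {L : Cplx.{v₁} R} {N : Cplx.{v₂} R}
    (ψ : Hom (RingHom.id R) L N) (φ : Hom (RingHom.id R) K L) : Hom (RingHom.id R) K N where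
  f n := (ψ.f n).comp (φ.f n)
  comm n c := by simp only [LinearMap.comp_apply, φ.comm, ψ.comm]

/-- A left inverse of a chain map `s`, up to chain homotopy. The homotopy formula is recorded in
positive degrees only, where it has no special case. -/
structure HomotopyLeftInverse {L : Cplx.{v₁} R} {K : Cplx.{v₂} R}
    (s : Hom (RingHom.id R) L K) where
  /-- the left inverse -/
  p : Hom (RingHom.id R) K L
  /-- the chain homotopy from the identity to `p ∘ s` -/
  h : ∀ n, L.C n →ₗ[R] L.C (n + 1)
  homotopy : ∀ n c,
    L.d (n + 1) (h (n + 1) c) + h n (L.d n c) = p.f (n + 1) (s.f (n + 1) c) - c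

namespace HomotopyLeftInverse

variable {L : Cplx.{v₁} R} {K : Cplx.{v₂} R} {s : Hom (RingHom.id R) L K}

/-- The induced homotopy left inverse on quotient complexes. -/
def quot (e : HomotopyLeftInverse s) (P : L.Sub) (Q : K.Sub)
    (hs : ∀ n, P.p n ≤ (Q.p n).comap (s.f n)) (hp : ∀ n, Q.p n ≤ (P.p n).comap (e.p.f n))
    (hh : ∀ n, P.p n ≤ (P.p (n + 1)).comap (e.h n)) :
    HomotopyLeftInverse (s.quot P Q hs) where
  p := e.p.quot Q P hp
  h n := Submodule.mapQ _ _ (e.h n) (hh n)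
  homotopy n c := by
    obtain ⟨c, rfl⟩ := Submodule.Quotient.mk_surjective _ c
    exact congrArg (Submodule.Quotient.mk (p := P.p (n + 1))) (e.homotopy n c)

/-- The induced homotopy left inverse on inverse limits of quotient complexes. -/
def lim (e : HomotopyLeftInverse s) {ι : Type w} [Preorder ι] (P : ι → L.Sub) (Q : ι → K.Sub)
    (hP : ∀ i j, i ≤ j → ∀ n, (P j).p n ≤ (P i).p n)
    (hQ : ∀ i j, i ≤ j → ∀ n, (Q j).p n ≤ (Q i).p n)
    (hs : ∀ i n, (P i).p n ≤ ((Q i).p n).comap (s.f n))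
    (hp : ∀ i n, (Q i).p n ≤ ((P i).p n).comap (e.p.f n))
    (hh : ∀ i n, (P i).p n ≤ ((P i).p (n + 1)).comap (e.h n)) :
    HomotopyLeftInverse (s.lim P Q hP hQ hs) where
  p := e.p.lim Q P hQ hP hp
  h n := ((LinearMap.pi fun i => (Submodule.mapQ _ _ (e.h n) (hh i n)).comp
      (LinearMap.proj i)).comp (L.limChains P hP n).subtype).codRestrict
    (L.limChains P hP (n + 1)) (fun c i j hij => by
      obtain ⟨b, hb⟩ := L.quotMk_surjective (P j) (c.1 j)
      change (L.factor (P j) (P i) (hP i j hij)).f (n + 1)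
        (Submodule.mapQ _ _ (e.h n) (hh j n) (c.1 j)) =
          Submodule.mapQ _ _ (e.h n) (hh i n) (c.1 i)
      rw [← c.2 i j hij, ← hb]
      rfl)
  homotopy n c := Subtype.ext (funext fun i =>
    (e.quot (P i) (Q i) (hs i) (hp i) (hh i)).homotopy n (c.1 i))

/-- A homotopy left inverse that does not increase semi-norms by more than the factor `C⁻¹` gives
a lower bound for the semi-norms of the images under `s` of homology classes: a cycle representing
the image of a class is mapped to a representative of this class. -/
theorem mul_homologyNorm_le (e : HomotopyLeftInverse s) {νL : ∀ n, L.C n → ℝ≥0∞}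
    {νK : ∀ n, K.C n → ℝ≥0∞} {C : ℝ≥0∞} {n : ℕ}
    (hν : ∀ c, C * νL (n + 1) (e.p.f (n + 1) c) ≤ νK (n + 1) c) (α : L.Homology (n + 1)) :
    C * L.homologyNorm νL (n + 1) α ≤ K.homologyNorm νK (n + 1) (s.homology (n + 1) α) := by
  refine le_iInf₂ fun z hz => le_trans ?_ (hν z)
  gcongr
  refine iInf₂_le (⟨e.p.f (n + 1) z, e.p.map_mem_cycles (n + 1) z⟩ : L.cycles (n + 1)) ?_
  obtain ⟨a, rfl⟩ := Submodule.Quotient.mk_surjective _ α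
  obtain ⟨w, hw⟩ := (Submodule.Quotient.eq _).mp hz
  have ha : L.d n a = 0 := a.2
  have hd := e.homotopy n a
  rw [ha, map_zero, add_zero] at hd
  refine (Submodule.Quotient.eq _).mpr ⟨e.p.f (n + 2) w + e.h (n + 1) a, ?_⟩
  have hw' : K.d (n + 1) w = z - s.f (n + 1) a := hw
  change _ = e.p.f (n + 1) z - (a : L.C (n + 1))
  rw [map_add, ← e.p.comm, hw', hd, map_sub]
  abel

end HomotopyLeftInverse

theorem mul_quotNorm_le {K : Cplx.{v₁} R} {L : Cplx.{v₂} R} (φ : Hom (RingHom.id R) K L)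
    {νK : ∀ n, K.C n → ℝ≥0∞} {νL : ∀ n, L.C n → ℝ≥0∞} (P : K.Sub) (Q : L.Sub)
    (h : ∀ n, P.p n ≤ (Q.p n).comap (φ.f n)) {C : ℝ≥0∞} {n : ℕ}
    (hν : ∀ c, C * νL n (φ.f n c) ≤ νK n c) (c : (K.quot P).C n) :
    C * L.quotNorm νL Q n ((φ.quot P Q h).f n c) ≤ K.quotNorm νK P n c := by
  refine le_iInf₂ fun b hb => le_trans ?_ (hν b)
  gcongr
  refine iInf₂_le (φ.f n b) ?_
  rw [← hb]
  rfl

/-- A family of extended non-negative real numbers that is Cauchy in the one-sided sense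
converges. -/
theorem exists_tendsto_of_le_add {ι : Type w} [SemilatticeSup ι] [Nonempty ι] (u : ι → ℝ≥0∞)
    (hu : ∀ ε : ℝ≥0∞, 0 < ε → ∃ k, ∀ i j, k ≤ i → k ≤ j → u i ≤ u j + ε) :
    ∃ r, Filter.Tendsto u Filter.atTop (nhds r) := by
  refine ⟨Filter.limsup u Filter.atTop, tendsto_of_le_liminf_of_limsup_le ?_ le_rfl⟩
  refine ENNReal.le_of_forall_pos_le_add fun ε hε _ => ?_
  obtain ⟨k, hk⟩ := hu ε (by exact_mod_cast hε)
  rw [← tsub_le_iff_right]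
  refine Filter.le_liminf_of_le (by isBoundedDefault) ?_
  filter_upwards [Filter.eventually_ge_atTop k] with j hj
  rw [tsub_le_iff_right]
  refine Filter.limsup_le_of_le (by isBoundedDefault) ?_
  filter_upwards [Filter.eventually_ge_atTop k] with i hi
  exact hk i j hi hj

/-- A bounded chain map sends a Cauchy family of representatives to a Cauchy family, whose
semi-norms converge to a limit that satisfies the same bound. -/
theorem mul_limNorm_le {K : Cplx.{v₁} R} {L : Cplx.{v₂} R} (φ : Hom (RingHom.id R) K L)
    {νK : ∀ n, K.C n → ℝ≥0∞} {νL : ∀ n, L.C n → ℝ≥0∞}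
    {ι : Type w} [SemilatticeSup ι] [Nonempty ι] (P : ι → K.Sub) (Q : ι → L.Sub)
    (hP : ∀ i j, i ≤ j → ∀ n, (P j).p n ≤ (P i).p n)
    (hQ : ∀ i j, i ≤ j → ∀ n, (Q j).p n ≤ (Q i).p n)
    (h : ∀ i n, (P i).p n ≤ ((Q i).p n).comap (φ.f n)) {C : ℝ≥0∞} (hC : C ≠ 0) (hCt : C ≠ ⊤)
    {n : ℕ}
    (hν : ∀ c, C * νL n (φ.f n c) ≤ νK n c)
    (htri : ∀ a b, νL n a ≤ νL n b + νL n (a - b)) (c : (K.lim P hP).C n) :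
    C * L.limNorm νL Q hQ n ((φ.lim P Q hP hQ h).f n c) ≤ K.limNorm νK P hP n c := by
  refine le_iInf₂ fun b hb => le_iInf₂ fun hcauchy r => le_iInf fun hr => ?_
  have hcauchy' : ∀ ε : ℝ≥0∞, 0 < ε → ∃ k, ∀ i j, k ≤ i → k ≤ j →
      νL n (φ.f n (b i) - φ.f n (b j)) < ε := by
    intro ε hε
    obtain ⟨k, hk⟩ := hcauchy (C * ε) (pos_iff_ne_zero.mpr (mul_ne_zero hC hε.ne'))
    refine ⟨k, fun i j hi hj => ?_⟩
    rw [← map_sub]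
    exact lt_of_mul_lt_mul_left' ((hν _).trans_lt (hk i j hi hj))
  obtain ⟨r', hr'⟩ := exists_tendsto_of_le_add (fun i => νL n (φ.f n (b i))) (by
    intro ε hε
    obtain ⟨k, hk⟩ := hcauchy' ε hε
    exact ⟨k, fun i j hi hj => (htri _ _).trans (by gcongr; exact (hk i j hi hj).le)⟩)
  have hle : L.limNorm νL Q hQ n ((φ.lim P Q hP hQ h).f n c) ≤ r' := by
    refine iInf₂_le_of_le (fun i => φ.f n (b i)) (fun i => ?_)
      (iInf₂_le_of_le hcauchy' r' (iInf_le _ hr'))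
    have := congrArg ((φ.quot (P i) (Q i) (h i)).f n) (hb i)
    exact this
  refine (mul_le_mul_right hle C).trans ?_
  exact le_of_tendsto_of_tendsto' (ENNReal.Tendsto.const_mul hr' (Or.inr hCt)) hr
    fun i => hν (b i)

end Cplx

/-! ### The `ℓ¹`-norm -/

section L1Norm

variable {B : Type v} {B' : Type w}

theorem l1Norm_eq_tsum (c : B →₀ ℝ) : l1Norm c = ∑' b, ‖c b‖ₑ := by
  rw [l1Norm, Finsupp.sum, tsum_eq_sum]
  intro b hb
  simp [Finsupp.notMem_support_iff.mp hb]

theorem l1Norm_zero : l1Norm (0 : B →₀ ℝ) = 0 := by simp [l1Norm]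

theorem l1Norm_single (b : B) (r : ℝ) : l1Norm (Finsupp.single b r) = ‖r‖ₑ := by
  simp [l1Norm]

theorem l1Norm_add_le (a b : B →₀ ℝ) : l1Norm (a + b) ≤ l1Norm a + l1Norm b := by
  simp only [l1Norm_eq_tsum, ← ENNReal.tsum_add]
  exact ENNReal.tsum_le_tsum fun x => enorm_add_le _ _

theorem l1Norm_smul (r : ℝ) (a : B →₀ ℝ) : l1Norm (r • a) = ‖r‖ₑ * l1Norm a := by
  simp only [l1Norm_eq_tsum, ← ENNReal.tsum_mul_left, Finsupp.smul_apply, smul_eq_mul, enorm_mul]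

theorem l1Norm_neg (a : B →₀ ℝ) : l1Norm (-a) = l1Norm a := by
  simp [l1Norm_eq_tsum]

theorem l1Norm_sub_le (a b : B →₀ ℝ) : l1Norm (a - b) ≤ l1Norm a + l1Norm b := by
  rw [sub_eq_add_neg, ← l1Norm_neg b]
  exact l1Norm_add_le a (-b)

theorem l1Norm_sum_le {ι : Type*} (s : Finset ι) (f : ι → B →₀ ℝ) :
    l1Norm (∑ i ∈ s, f i) ≤ ∑ i ∈ s, l1Norm (f i) :=
  Finset.le_sum_of_subadditive _ l1Norm_zero.le l1Norm_add_le s f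

/-- A linear map on a free module is bounded by the norms of the images of the basis vectors. -/
theorem l1Norm_linearCombination_le (f : B → B' →₀ ℝ) {C : ℝ≥0∞} (hf : ∀ b, l1Norm (f b) ≤ C)
    (c : B →₀ ℝ) : l1Norm (Finsupp.linearCombination ℝ f c) ≤ C * l1Norm c := by
  rw [Finsupp.linearCombination_apply, Finsupp.sum, l1Norm.eq_1 c, Finsupp.sum, Finset.mul_sum]
  refine (l1Norm_sum_le _ _).trans (Finset.sum_le_sum fun b _ => ?_)
  rw [l1Norm_smul, mul_comm]
  gcongr
  exact hf b

theorem l1Norm_mapDomain_le (f : B → B') (c : B →₀ ℝ) :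
    l1Norm (Finsupp.mapDomain f c) ≤ l1Norm c := by
  have h := l1Norm_linearCombination_le (fun b => Finsupp.single (f b) (1 : ℝ)) (C := 1)
    (fun b => by simp [l1Norm_single]) c
  rw [one_mul] at h
  convert h using 2
  simp [Finsupp.mapDomain, Finsupp.linearCombination_apply]

end L1Norm

/-! ### Natural operators given by model chains -/

section Models

variable {A : Type v} [TopologicalSpace A] {X : Type w} [TopologicalSpace X]

/-- The pushforward of singular chains along a continuous map, between spaces that may live in
different universes. -/
noncomputable def push (f : C(A, X)) (k : ℕ) : SingChain ℝ A k →ₗ[ℝ] SingChain ℝ X k :=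
  Finsupp.lmapDomain ℝ ℝ (fun σ : SingSimplex k A => f.comp σ)

theorem push_single (f : C(A, X)) {k : ℕ} (σ : SingSimplex k A) (r : ℝ) :
    push f k (Finsupp.single σ r) = Finsupp.single (f.comp σ) r :=
  Finsupp.mapDomain_single

theorem push_push {Y : Type v₁} [TopologicalSpace Y] (g : C(X, Y)) (f : C(A, X)) {k : ℕ}
    (c : SingChain ℝ A k) : push g k (push f k c) = push (g.comp f) k c :=
  Finsupp.mapDomain_comp.symm

theorem singD_push (f : C(A, X)) {k : ℕ} (c : SingChain ℝ A (k + 1)) :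
    singD ℝ X k (push f (k + 1) c) = push f k (singD ℝ A k c) := by
  induction c using Finsupp.induction_linear with
  | zero => simp only [map_zero]
  | add a b ha hb => simp only [map_add, ha, hb]
  | single τ r =>
    simp only [push_single, singD_single, map_sum, map_smul]
    rfl

/-- The operator on chains freely generated by the maps `A → X` that sends such a map `τ` to the
pushforward along `τ` of a fixed singular chain `e` of the model space `A`. For varying `X` these
are the natural operators; the model spaces used are simplices and cubes. -/
noncomputable def modelOp (X : Type w) [TopologicalSpace X] {k : ℕ} (e : SingChain ℝ A k) :
    (C(A, X) →₀ ℝ) →ₗ[ℝ] SingChain ℝ X k :=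
  Finsupp.linearCombination ℝ (fun τ : C(A, X) => push τ k e)

theorem modelOp_single {k : ℕ} (e : SingChain ℝ A k) (τ : C(A, X)) (r : ℝ) :
    modelOp X e (Finsupp.single τ r) = r • push τ k e :=
  Finsupp.linearCombination_single ℝ r τ

theorem modelOp_sub {k : ℕ} (e e' : SingChain ℝ A k) (c : C(A, X) →₀ ℝ) :
    modelOp X (e - e') c = modelOp X e c - modelOp X e' c := by
  simp only [modelOp, Finsupp.linearCombination_apply, map_sub, smul_sub, Finsupp.sum_sub]

theorem modelOp_zero {k : ℕ} (c : C(A, X) →₀ ℝ) :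
    modelOp X (0 : SingChain ℝ A k) c = 0 := by
  simp [modelOp, Finsupp.linearCombination_apply]

theorem singD_modelOp {k : ℕ} (e : SingChain ℝ A (k + 1)) (c : C(A, X) →₀ ℝ) :
    singD ℝ X k (modelOp X e c) = modelOp X (singD ℝ A k e) c := by
  induction c using Finsupp.induction_linear with
  | zero => simp only [map_zero]
  | add a b ha hb => simp only [map_add, ha, hb]
  | single τ r => simp only [modelOp_single, map_smul, singD_push]

theorem push_modelOp {Y : Type v₁} [TopologicalSpace Y] (f : C(X, Y)) {k : ℕ}
    (e : SingChain ℝ A k) (c : C(A, X) →₀ ℝ) :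
    push f k (modelOp X e c) =
      modelOp Y e (Finsupp.lmapDomain ℝ ℝ (fun τ : C(A, X) => f.comp τ) c) := by
  induction c using Finsupp.induction_linear with
  | zero => simp only [map_zero]
  | add a b ha hb => simp only [map_add, ha, hb]
  | single τ r =>
    simp only [modelOp_single, map_smul, push_push, Finsupp.lmapDomain_apply,
      Finsupp.mapDomain_single]

theorem l1Norm_modelOp_le {k : ℕ} (e : SingChain ℝ A k) (c : C(A, X) →₀ ℝ) :
    l1Norm (modelOp X e c) ≤ l1Norm e * l1Norm c :=
  l1Norm_linearCombination_le _ (fun _ => l1Norm_mapDomain_le _ _) c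

/-- The identity of the model space, as a chain. -/
noncomputable def fundChain (A : Type v) [TopologicalSpace A] : C(A, A) →₀ ℝ :=
  Finsupp.single (ContinuousMap.id A) 1

/-- A model chain is the value of its operator on the identity of the model space. -/
theorem modelOp_fundChain {k : ℕ} (e : SingChain ℝ A k) : modelOp A e (fundChain A) = e := by
  rw [fundChain, modelOp_single, one_smul]
  have : (fun σ : SingSimplex k A => (ContinuousMap.id A).comp σ) = id := rfl
  change Finsupp.mapDomain _ e = e
  rw [this, Finsupp.mapDomain_id]

/-- A linear operator that is natural is given by its model chain. -/
theorem eq_modelOp_of_natural {k : ℕ}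
    (T : (C(A, X) →₀ ℝ) →ₗ[ℝ] SingChain ℝ X k) (e : SingChain ℝ A k)
    (h : ∀ τ, T (Finsupp.single τ 1) = push τ k e) : T = modelOp X e := by
  refine Finsupp.lhom_ext fun τ r => ?_
  rw [modelOp_single, ← h, ← map_smul, Finsupp.smul_single, smul_eq_mul, mul_one]

/-- The identity operator on singular chains is given by the fundamental chain of the simplex. -/
theorem modelOp_fundChain_simplex (k : ℕ) (c : SingChain ℝ X k) :
    modelOp X (fundChain (stdSimplex ℝ (Fin (k + 1)))) c = c := by
  induction c using Finsupp.induction_linear with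
  | zero => simp only [map_zero]
  | add a b ha hb => simp only [map_add, ha, hb]
  | single τ r =>
    rw [modelOp_single, fundChain, push_single, Finsupp.smul_single, smul_eq_mul, mul_one]
    rfl

/-- A natural operator applied to a boundary is given by its value on the boundary of the
fundamental chain of the simplex. -/
theorem modelOp_singD {k l : ℕ} (e : SingChain ℝ (stdSimplex ℝ (Fin (k + 1))) l)
    (c : SingChain ℝ X (k + 1)) :
    modelOp X e (singD ℝ X k c) =
      modelOp X (modelOp _ e (singD ℝ _ k (fundChain (stdSimplex ℝ (Fin (k + 2)))))) c := by
  induction c using Finsupp.induction_linear with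
  | zero => simp only [map_zero]
  | add a b ha hb => simp only [map_add, ha, hb]
  | single τ r =>
    rw [modelOp_single, push_modelOp]
    simp only [fundChain, singD_single, map_sum, map_smul, Finsupp.lmapDomain_apply,
      Finsupp.mapDomain_single, modelOp_single, Finset.smul_sum, one_smul]
    refine Finset.sum_congr rfl fun i _ => ?_
    rw [smul_comm]
    rfl

/-- A natural operator applied to a cubical boundary is given by its value on the boundary of the
fundamental chain of the cube. -/
theorem modelOp_cubeD {k l : ℕ} (e : SingChain ℝ (Fin k → unitInterval) l)
    (c : CubeChain X (k + 1)) :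
    modelOp X e (cubeD X k c) =
      modelOp X (modelOp _ e (cubeD _ k (fundChain (Fin (k + 1) → unitInterval)))) c := by
  induction c using Finsupp.induction_linear with
  | zero => simp only [map_zero]
  | add a b ha hb => simp only [map_add, ha, hb]
  | single τ r =>
    rw [modelOp_single, push_modelOp]
    simp only [fundChain, cubeD_single, map_sum, map_smul, map_sub, Finsupp.lmapDomain_apply,
      Finsupp.mapDomain_single, modelOp_single, Finset.smul_sum, one_smul]
    refine Finset.sum_congr rfl fun i _ => ?_
    rw [smul_comm r, smul_sub r]
    rfl

end Models

/-! ### Cones -/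

section Cone

open Topology

/-- The map `[0, 1] × Δⁿ → Δⁿ⁺¹`, `(s, t) ↦ (s, (1 - s) t)`, that exhibits `Δⁿ⁺¹` as the cone
over `Δⁿ`. -/
def simplexJoin (n : ℕ) :
    C(unitInterval × stdSimplex ℝ (Fin (n + 1)), stdSimplex ℝ (Fin (n + 2))) where
  toFun x := ⟨Fin.cons (x.1 : ℝ) fun i => (1 - (x.1 : ℝ)) * x.2.1 i, by
    constructor
    · intro i
      refine Fin.cases ?_ (fun k => ?_) i
      · simpa using x.1.2.1
      · simpa using mul_nonneg (sub_nonneg.mpr x.1.2.2) (x.2.2.1 k)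
    · rw [Fin.sum_univ_succ]
      have := x.2.2.2
      simp only [Fin.cons_zero, Fin.cons_succ, ← Finset.mul_sum, this]
      ring⟩
  continuous_toFun := by
    refine Continuous.subtype_mk (continuous_pi fun i => ?_) _
    refine Fin.cases ?_ (fun k => ?_) i
    · simp only [Fin.cons_zero]
      fun_prop
    · simp only [Fin.cons_succ]
      have : Continuous fun x : unitInterval × stdSimplex ℝ (Fin (n + 1)) =>
        x.2.1 k := (continuous_apply k).comp (continuous_subtype_val.comp continuous_snd)
      fun_prop

theorem simplexJoin_surjective (n : ℕ) : Function.Surjective (simplexJoin n) := by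
  intro t
  have hsum : t.1 0 + ∑ i : Fin (n + 1), t.1 i.succ = 1 := by
    rw [← Fin.sum_univ_succ]
    exact t.2.2
  have hnn : ∀ i, 0 ≤ t.1 i := t.2.1
  rcases eq_or_ne (t.1 0) 1 with h1 | h1
  · -- at the apex the second component is arbitrary
    have hz : ∀ i : Fin (n + 1), t.1 i.succ = 0 := by
      have h0 : ∑ i : Fin (n + 1), t.1 i.succ = 0 := by linarith
      intro i
      exact (Finset.sum_eq_zero_iff_of_nonneg fun i _ => hnn i.succ).mp h0 i (Finset.mem_univ i)
    refine ⟨(1, ⟨Pi.single 0 1, single_mem_stdSimplex ℝ 0⟩), Subtype.ext (funext fun i => ?_)⟩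
    refine Fin.cases ?_ (fun k => ?_) i
    · simp [simplexJoin, h1]
    · simp [simplexJoin, hz]
  · have hle : t.1 0 ≤ 1 := by
      have := Finset.sum_nonneg fun (i : Fin (n + 1)) (_ : i ∈ Finset.univ) => hnn i.succ
      linarith
    have hpos : 0 < 1 - t.1 0 := sub_pos.mpr (lt_of_le_of_ne hle h1)
    refine ⟨(⟨t.1 0, hnn 0, hle⟩,
      ⟨fun i => t.1 i.succ / (1 - t.1 0), ?_, ?_⟩),
      Subtype.ext (funext fun i => ?_)⟩
    · exact fun i => div_nonneg (hnn _) hpos.le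
    · rw [← Finset.sum_div, div_eq_one_iff_eq hpos.ne']
      linarith
    · refine Fin.cases ?_ (fun k => ?_) i
      · simp [simplexJoin]
      · simp only [simplexJoin, ContinuousMap.coe_mk, Fin.cons_succ]
        field_simp

theorem isQuotientMap_simplexJoin (n : ℕ) : IsQuotientMap (simplexJoin n) :=
  IsQuotientMap.of_surjective_continuous (simplexJoin_surjective n) (simplexJoin n).continuous

theorem simplexFace_zero_eq (n : ℕ) (t : stdSimplex ℝ (Fin (n + 1))) :
    simplexFace n 0 t = simplexJoin n (0, t) := by
  refine Subtype.ext (funext fun i => ?_)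
  refine Fin.cases ?_ (fun k => ?_) i
  · simp [simplexFace, simplexJoin]
  · simp only [simplexFace, simplexJoin, ContinuousMap.coe_mk, Fin.insertNth_zero', Fin.cons_succ,
      Set.Icc.coe_zero, sub_zero, one_mul]
    rfl

theorem simplexFace_succ_join (n : ℕ) (i : Fin (n + 2)) (s : unitInterval)
    (t : stdSimplex ℝ (Fin (n + 1))) :
    simplexFace (n + 1) i.succ (simplexJoin n (s, t)) =
      simplexJoin (n + 1) (s, simplexFace n i t) := by
  refine Subtype.ext ?_
  change (i.succ.insertNth (0 : ℝ) (Fin.cons (s : ℝ) fun i => (1 - (s : ℝ)) *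
    (t : Fin (n + 1) → ℝ) i : Fin (n + 2) → ℝ) : Fin (n + 3) → ℝ) =
    Fin.cons (s : ℝ) fun k => (1 - (s : ℝ)) *
      (i.insertNth (0 : ℝ) (t : Fin (n + 1) → ℝ) : Fin (n + 2) → ℝ) k
  rw [mul_insertNth, Fin.insertNth_succ_cons]

variable {A : Type v} [TopologicalSpace A] {p : A}

theorem factorsThrough_simplexJoin (H : (ContinuousMap.id A).Homotopy (ContinuousMap.const A p))
    {n : ℕ} (σ : SingSimplex n A) :
    Function.FactorsThrough
      (H.toContinuousMap.comp ((ContinuousMap.id unitInterval).prodMap σ)) (simplexJoin n) := by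
  rintro ⟨s, t⟩ ⟨s', t'⟩ h
  have h' := fun i => congrFun (congrArg Subtype.val h) i
  have h0 : s = s' := Subtype.ext (by simpa [simplexJoin] using h' 0)
  subst h0
  rcases eq_or_ne s 1 with rfl | hs
  · change H (1, σ t) = H (1, σ t')
    simp
  · have hs' : 1 - (s : ℝ) ≠ 0 := by
      intro h
      exact hs (Subtype.ext (by simpa using (sub_eq_zero.mp h).symm))
    have : t = t' := Subtype.ext (funext fun i => by
      have := h' i.succ
      simp only [simplexJoin, ContinuousMap.coe_mk, Fin.cons_succ] at this
      exact mul_left_cancel₀ hs' this)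
    rw [this]

/-- The cone over a singular simplex of a space `A` with respect to a contraction of `A`. -/
noncomputable def coneSimplex
    (H : (ContinuousMap.id A).Homotopy (ContinuousMap.const A p)) {n : ℕ}
    (σ : SingSimplex n A) : SingSimplex (n + 1) A :=
  (isQuotientMap_simplexJoin n).lift _ (factorsThrough_simplexJoin H σ)

theorem coneSimplex_join (H : (ContinuousMap.id A).Homotopy (ContinuousMap.const A p)) {n : ℕ}
    (σ : SingSimplex n A) (s : unitInterval) (t : stdSimplex ℝ (Fin (n + 1))) :
    coneSimplex H σ (simplexJoin n (s, t)) = H (s, σ t) :=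
  DFunLike.congr_fun ((isQuotientMap_simplexJoin n).lift_comp _
    (factorsThrough_simplexJoin H σ)) (s, t)

theorem coneSimplex_face_zero (H : (ContinuousMap.id A).Homotopy (ContinuousMap.const A p))
    {n : ℕ} (σ : SingSimplex n A) : (coneSimplex H σ).comp (simplexFace n 0) = σ := by
  ext t
  rw [ContinuousMap.comp_apply, simplexFace_zero_eq, coneSimplex_join]
  simp

theorem coneSimplex_face_succ (H : (ContinuousMap.id A).Homotopy (ContinuousMap.const A p))
    {n : ℕ} (σ : SingSimplex (n + 1) A) (i : Fin (n + 2)) :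
    (coneSimplex H σ).comp (simplexFace (n + 1) i.succ) =
      coneSimplex H (σ.comp (simplexFace n i)) := by
  ext t
  obtain ⟨⟨s, t⟩, rfl⟩ := simplexJoin_surjective n t
  rw [ContinuousMap.comp_apply, simplexFace_succ_join, coneSimplex_join, coneSimplex_join]
  rfl

/-- The cone operator on singular chains. -/
noncomputable def cone (H : (ContinuousMap.id A).Homotopy (ContinuousMap.const A p)) (n : ℕ) :
    SingChain ℝ A n →ₗ[ℝ] SingChain ℝ A (n + 1) :=
  Finsupp.lmapDomain ℝ ℝ (coneSimplex H)

theorem singD_cone (H : (ContinuousMap.id A).Homotopy (ContinuousMap.const A p)) {n : ℕ}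
    (c : SingChain ℝ A (n + 1)) :
    singD ℝ A (n + 1) (cone H (n + 1) c) = c - cone H n (singD ℝ A n c) := by
  induction c using Finsupp.induction_linear with
  | zero => simp only [map_zero, sub_zero]
  | add a b ha hb => simp only [map_add, ha, hb]; abel
  | single σ r =>
    simp only [cone, singD_single, map_sum, map_smul, Finsupp.lmapDomain_apply,
      Finsupp.mapDomain_single]
    rw [Fin.sum_univ_succ, coneSimplex_face_zero]
    simp only [coneSimplex_face_succ, Fin.val_succ, pow_succ, mul_neg_one, neg_smul,
      Finset.sum_neg_distrib, sub_eq_add_neg, Fin.val_zero, pow_zero, one_smul]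

theorem singD_cone_of_cycle (H : (ContinuousMap.id A).Homotopy (ContinuousMap.const A p)) {n : ℕ}
    {c : SingChain ℝ A (n + 1)} (hc : singD ℝ A n c = 0) :
    singD ℝ A (n + 1) (cone H (n + 1) c) = c := by
  rw [singD_cone, hc, map_zero, sub_zero]

/-- The linear contraction of the cube to its vertex `0`. -/
def cubeContraction (n : ℕ) : (ContinuousMap.id (Fin n → unitInterval)).Homotopy
    (ContinuousMap.const _ (fun _ => (0 : unitInterval))) where
  toFun x := fun i => unitInterval.symm x.1 * x.2 i
  continuous_toFun := by fun_prop
  map_zero_left x := by ext; simp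
  map_one_left x := by ext; simp

theorem exists_simplexContraction (n : ℕ) : ∃ p : stdSimplex ℝ (Fin (n + 1)),
    ((ContinuousMap.id (stdSimplex ℝ (Fin (n + 1)))).Homotopic (ContinuousMap.const _ p)) := by
  have : ContractibleSpace (stdSimplex ℝ (Fin (n + 1))) :=
    (convex_stdSimplex ℝ (Fin (n + 1))).contractibleSpace ⟨_, single_mem_stdSimplex ℝ 0⟩
  exact id_nullhomotopic _

/-- A contraction of the standard simplex. -/
noncomputable def simplexContraction (n : ℕ) :
    (ContinuousMap.id (stdSimplex ℝ (Fin (n + 1)))).Homotopy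
      (ContinuousMap.const _ (exists_simplexContraction n).choose) :=
  (exists_simplexContraction n).choose_spec.some

end Cone

/-! ### Antisymmetrization of cubes under coordinate reflections -/

section Reflection

variable {X : Type v} [TopologicalSpace X]

/-- The reflection of the cube in all coordinates `i` with `ε i = true`. -/
def reflect {n : ℕ} (ε : Fin n → Bool) : C(Fin n → unitInterval, Fin n → unitInterval) where
  toFun x i := bif ε i then unitInterval.symm (x i) else x i
  continuous_toFun := by
    refine continuous_pi fun i => ?_
    cases ε i
    · exact continuous_apply i
    · exact unitInterval.continuous_symm.comp (continuous_apply i)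

/-- The sign of a composition of coordinate reflections. -/
def reflectSign {n : ℕ} (ε : Fin n → Bool) : ℝ := ∏ i, bif ε i then -1 else 1

theorem reflectSign_insertNth {n : ℕ} (j : Fin (n + 1)) (b : Bool) (ε : Fin n → Bool) :
    reflectSign (j.insertNth b ε : Fin (n + 1) → Bool) =
      (bif b then -1 else 1) * reflectSign ε := by
  simp [reflectSign, Fin.prod_univ_succAbove _ j]

theorem enorm_reflectSign {n : ℕ} (ε : Fin n → Bool) : ‖reflectSign ε‖ₑ = 1 := by
  rw [reflectSign, enorm_eq_nnnorm, nnnorm_prod, Finset.prod_eq_one]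
  · simp
  · intro i _
    cases ε i <;> simp

theorem reflect_insertNth {n : ℕ} (j : Fin (n + 1)) (b : Bool) (ε : Fin n → Bool)
    (a : unitInterval) :
    (reflect (j.insertNth b ε : Fin (n + 1) → Bool)).comp (cubeFace n j a) =
      (cubeFace n j (bif b then unitInterval.symm a else a)).comp (reflect ε) := by
  refine ContinuousMap.ext fun x => funext fun k => ?_
  refine Fin.succAboveCases j ?_ (fun l => ?_) k <;> simp [reflect, cubeFace]

/-- The antisymmetrization of cubical chains under coordinate reflections: the signed average over
the `2ⁿ` compositions of reflections. -/
noncomputable def antisymm (X : Type v) [TopologicalSpace X] (n : ℕ) :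
    CubeChain X n →ₗ[ℝ] CubeChain X n :=
  ∑ ε : Fin n → Bool, ((1 / 2 : ℝ) ^ n * reflectSign ε) •
    Finsupp.lmapDomain ℝ ℝ (fun c : SingCube n X => c.comp (reflect ε))

theorem antisymm_single {n : ℕ} (c : SingCube n X) (r : ℝ) :
    antisymm X n (Finsupp.single c r) = ∑ ε : Fin n → Bool,
      ((1 / 2 : ℝ) ^ n * reflectSign ε) • Finsupp.single (c.comp (reflect ε)) r := by
  simp [antisymm, LinearMap.sum_apply, Finsupp.lmapDomain_apply, Finsupp.mapDomain_single]

theorem sum_insertNth {n : ℕ} {V : Type w} [AddCommMonoid V] (j : Fin (n + 1))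
    (f : (Fin (n + 1) → Bool) → V) :
    ∑ ε, f ε = ∑ ε : Fin n → Bool, (f (j.insertNth false ε) + f (j.insertNth true ε)) := by
  rw [← (Fin.insertNthEquiv (fun _ => Bool) j).sum_comp, Fintype.sum_prod_type, Fintype.sum_bool,
    ← Finset.sum_add_distrib]
  exact Finset.sum_congr rfl fun ε _ => add_comm _ _

theorem antisymm_cubeD {n : ℕ} (c : CubeChain X (n + 1)) :
    antisymm X n (cubeD X n c) = cubeD X n (antisymm X (n + 1) c) := by
  induction c using Finsupp.induction_linear with
  | zero => simp only [map_zero]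
  | add a b ha hb => simp only [map_add, ha, hb]
  | single c r =>
    rw [cubeD_single, antisymm_single, map_sum, map_sum]
    simp only [map_smul, map_sub, antisymm_single, cubeD_single, Finset.smul_sum]
    rw [Finset.sum_comm]
    refine Finset.sum_congr rfl fun j _ => ?_
    rw [sum_insertNth j, ← Finset.sum_sub_distrib, Finset.smul_sum]
    refine Finset.sum_congr rfl fun ε _ => ?_
    -- the reflection in the `j`-th coordinate exchanges the two `j`-th faces and changes the sign
    simp only [ContinuousMap.comp_assoc, reflect_insertNth, reflectSign_insertNth, cond_true,
      cond_false, unitInterval.symm_zero, unitInterval.symm_one]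
    module

theorem antisymm_of_isDegenerate {n : ℕ} {c : SingCube n X} (hc : IsDegenerate c) (r : ℝ) :
    antisymm X n (Finsupp.single c r) = 0 := by
  obtain ⟨j, hj⟩ := hc
  cases n with
  | zero => exact j.elim0
  | succ n =>
    rw [antisymm_single, sum_insertNth j]
    refine Finset.sum_eq_zero fun ε _ => ?_
    have : c.comp (reflect (j.insertNth false ε : Fin (n + 1) → Bool)) =
        c.comp (reflect (j.insertNth true ε : Fin (n + 1) → Bool)) := by
      ext x
      rw [ContinuousMap.comp_apply, ContinuousMap.comp_apply, ← hj _ (unitInterval.symm (x j))]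
      congr 1
      funext k
      refine Fin.succAboveCases j ?_ (fun l => ?_) k <;> simp [reflect]
    rw [this, reflectSign_insertNth, reflectSign_insertNth, cond_true, cond_false]
    module

theorem degenerate_le_ker_antisymm (X : Type v) [TopologicalSpace X] (n : ℕ) :
    degenerate X n ≤ LinearMap.ker (antisymm X n) := by
  refine Submodule.span_le.mpr ?_
  rintro _ ⟨c, hc, rfl⟩
  exact antisymm_of_isDegenerate hc 1

theorem l1Norm_antisymm_le {n : ℕ} (c : CubeChain X n) : l1Norm (antisymm X n c) ≤ l1Norm c := by
  rw [antisymm, LinearMap.sum_apply]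
  refine (l1Norm_sum_le _ _).trans ?_
  have h : ∀ ε : Fin n → Bool, l1Norm ((((1 / 2 : ℝ) ^ n * reflectSign ε) •
      Finsupp.lmapDomain ℝ ℝ (fun c : SingCube n X => c.comp (reflect ε))) c) ≤
      (2 ^ n : ℝ≥0∞)⁻¹ * l1Norm c := by
    intro ε
    rw [LinearMap.smul_apply, l1Norm_smul, enorm_mul, enorm_reflectSign, mul_one, one_div,
      enorm_pow, enorm_inv two_ne_zero, ← ENNReal.inv_pow]
    have : ‖(2 : ℝ)‖ₑ = 2 := by simp [enorm_eq_nnnorm]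
    rw [this]
    gcongr
    exact l1Norm_mapDomain_le _ _
  refine (Finset.sum_le_sum fun ε _ => h ε).trans_eq ?_
  rw [Finset.sum_const, Finset.card_univ, Fintype.card_fun, Fintype.card_bool, Fintype.card_fin,
    nsmul_eq_mul, ← mul_assoc]
  push_cast
  rw [ENNReal.mul_inv_cancel (by simp) (by simp), one_mul]

theorem antisymm_zero (c : CubeChain X 0) : antisymm X 0 c = c := by
  induction c using Finsupp.induction_linear with
  | zero => simp only [map_zero]
  | add a b ha hb => simp only [map_add, ha, hb]
  | single c r =>
    rw [antisymm_single, Fintype.sum_unique]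
    have : ∀ ε, c.comp (reflect ε) = c := by
      intro ε
      ext x
      rw [ContinuousMap.comp_apply, Subsingleton.elim (reflect ε x) x]
    rw [this]
    simp [reflectSign]

theorem antisymm_map {Y : Type w} [TopologicalSpace Y] (f : C(X, Y)) {n : ℕ}
    (c : CubeChain X n) :
    antisymm Y n (Finsupp.lmapDomain ℝ ℝ (fun c : SingCube n X => f.comp c) c) =
      Finsupp.lmapDomain ℝ ℝ (fun c : SingCube n X => f.comp c) (antisymm X n c) := by
  induction c using Finsupp.induction_linear with
  | zero => simp only [map_zero]
  | add a b ha hb => simp only [map_add, ha, hb]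
  | single c r =>
    simp only [antisymm_single, map_sum, map_smul, Finsupp.lmapDomain_apply,
      Finsupp.mapDomain_single]
    rfl

/-- Antisymmetrization as a chain map from the cubical chain complex to the complex of all
cubical chains. -/
noncomputable def antisymmHom (X : Type v) [TopologicalSpace X] :
    Cplx.Hom (RingHom.id ℝ) (cub X) (cube X) where
  f n := (degenerate X n).liftQ (antisymm X n) (degenerate_le_ker_antisymm X n)
  comm n c := by
    obtain ⟨c, rfl⟩ := Submodule.Quotient.mk_surjective _ c
    exact antisymm_cubeD c

end Reflection

/-! ### Triangulations of cubes -/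

section Triangulation

/-- The affine simplex in the cube with the given ordered vertices. -/
def affineSimplex {k n : ℕ} (v : Fin (k + 1) → Fin n → unitInterval) :
    SingSimplex k (Fin n → unitInterval) where
  toFun t i := ⟨∑ l, t.1 l * v l i,
    Finset.sum_nonneg fun l _ => mul_nonneg (t.2.1 l) (v l i).2.1,
    (Finset.sum_le_sum fun l _ => mul_le_of_le_one_right (t.2.1 l) (v l i).2.2).trans_eq t.2.2⟩
  continuous_toFun := by
    refine continuous_pi fun i => Continuous.subtype_mk ?_ _
    exact continuous_finsetSum _ fun l _ =>
      ((continuous_apply l).comp continuous_subtype_val).mul continuous_const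

theorem affineSimplex_comp_simplexFace {k n : ℕ} (v : Fin (k + 2) → Fin n → unitInterval)
    (i : Fin (k + 2)) :
    (affineSimplex v).comp (simplexFace k i) = affineSimplex (fun l => v (i.succAbove l)) := by
  refine ContinuousMap.ext fun t => funext fun m => Subtype.ext ?_
  change ∑ l, (i.insertNth (0 : ℝ) t.1 : Fin (k + 2) → ℝ) l * (v l m : ℝ) =
    ∑ l, t.1 l * (v (i.succAbove l) m : ℝ)
  rw [Fin.sum_univ_succAbove _ i]
  simp

theorem cubeFace_comp_affineSimplex {k n : ℕ} (v : Fin (k + 1) → Fin n → unitInterval)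
    (j : Fin (n + 1)) (a : unitInterval) :
    (cubeFace n j a).comp (affineSimplex v) = affineSimplex (fun l => j.insertNth a (v l)) := by
  refine ContinuousMap.ext fun t => funext fun m => Subtype.ext ?_
  have hsum : ∑ l, t.1 l = 1 := t.2.2
  refine Fin.succAboveCases j ?_ (fun l => ?_) m
  · simp [cubeFace, affineSimplex, ← Finset.sum_mul, hsum]
  · simp [cubeFace, affineSimplex]

/-- The affine simplex with the given ordered vertices, as a singular chain. -/
noncomputable def vertexSimplex {k n : ℕ} (v : Fin (k + 1) → Fin n → unitInterval) :
    SingChain ℝ (Fin n → unitInterval) k :=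
  Finsupp.single (affineSimplex v) 1

theorem singD_vertexSimplex {k n : ℕ} (v : Fin (k + 2) → Fin n → unitInterval) :
    singD ℝ _ k (vertexSimplex v) =
      ∑ i : Fin (k + 2), (-1 : ℝ) ^ (i : ℕ) • vertexSimplex (fun l => v (i.succAbove l)) := by
  simp only [vertexSimplex, singD_single, affineSimplex_comp_simplexFace]

theorem singD_vertexSimplex_one {n : ℕ} (a b : Fin n → unitInterval) :
    singD ℝ _ 0 (vertexSimplex ![a, b]) = vertexSimplex ![b] - vertexSimplex ![a] := by
  rw [singD_vertexSimplex, Fin.sum_univ_two]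
  have h0 : (fun l => ![a, b] (Fin.succAbove 0 l)) = ![b] := by ext l; fin_cases l; rfl
  have h1 : (fun l => ![a, b] (Fin.succAbove 1 l)) = ![a] := by ext l; fin_cases l; rfl
  rw [h0, h1]
  simp [sub_eq_add_neg]

theorem singD_vertexSimplex_two {n : ℕ} (a b c : Fin n → unitInterval) :
    singD ℝ _ 1 (vertexSimplex ![a, b, c]) =
      vertexSimplex ![b, c] - vertexSimplex ![a, c] + vertexSimplex ![a, b] := by
  rw [singD_vertexSimplex, Fin.sum_univ_three]
  have h0 : (fun l => ![a, b, c] (Fin.succAbove 0 l)) = ![b, c] := by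
    ext l; fin_cases l <;> rfl
  have h1 : (fun l => ![a, b, c] (Fin.succAbove 1 l)) = ![a, c] := by
    ext l; fin_cases l <;> rfl
  have h2 : (fun l => ![a, b, c] (Fin.succAbove 2 l)) = ![a, b] := by
    ext l; fin_cases l <;> rfl
  rw [h0, h1, h2]
  simp [sub_eq_add_neg]

theorem singD_vertexSimplex_three {n : ℕ} (a b c d : Fin n → unitInterval) :
    singD ℝ _ 2 (vertexSimplex ![a, b, c, d]) =
      vertexSimplex ![b, c, d] - vertexSimplex ![a, c, d] + vertexSimplex ![a, b, d] -
        vertexSimplex ![a, b, c] := by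
  rw [singD_vertexSimplex, Fin.sum_univ_four]
  have h0 : (fun l => ![a, b, c, d] (Fin.succAbove 0 l)) = ![b, c, d] := by
    ext l; fin_cases l <;> rfl
  have h1 : (fun l => ![a, b, c, d] (Fin.succAbove 1 l)) = ![a, c, d] := by
    ext l; fin_cases l <;> rfl
  have h2 : (fun l => ![a, b, c, d] (Fin.succAbove 2 l)) = ![a, b, d] := by
    ext l; fin_cases l <;> rfl
  have h3 : (fun l => ![a, b, c, d] (Fin.succAbove 3 l)) = ![a, b, c] := by
    ext l; fin_cases l <;> rfl
  rw [h0, h1, h2, h3]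
  simp [sub_eq_add_neg, pow_succ]

theorem push_cubeFace_vertexSimplex {k n : ℕ} (v : Fin (k + 1) → Fin n → unitInterval)
    (j : Fin (n + 1)) (a : unitInterval) :
    push (cubeFace n j a) k (vertexSimplex v) =
      vertexSimplex (fun l => j.insertNth a (v l)) := by
  rw [vertexSimplex, push_single, cubeFace_comp_affineSimplex, vertexSimplex]

theorem vertexSimplex_map_one {n m : ℕ} (f : (Fin n → unitInterval) → Fin m → unitInterval)
    (a b : Fin n → unitInterval) :
    vertexSimplex (fun l => f (![a, b] l)) = vertexSimplex ![f a, f b] :=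
  congrArg vertexSimplex (by funext l; fin_cases l <;> rfl)

theorem vertexSimplex_map_two {n m : ℕ} (f : (Fin n → unitInterval) → Fin m → unitInterval)
    (a b c : Fin n → unitInterval) :
    vertexSimplex (fun l => f (![a, b, c] l)) = vertexSimplex ![f a, f b, f c] :=
  congrArg vertexSimplex (by funext l; fin_cases l <;> rfl)

/-- The average of the two triangulations of the square. -/
noncomputable def squareChain : SingChain ℝ (Fin 2 → unitInterval) 2 :=
  (1 / 2 : ℝ) • (
      vertexSimplex ![![0, 0], ![1, 0], ![1, 1]] - vertexSimplex ![![0, 0], ![0, 1], ![1, 1]]) +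
    (1 / 2 : ℝ) • (
      vertexSimplex ![![0, 1], ![1, 0], ![1, 1]] - vertexSimplex ![![0, 0], ![0, 1], ![1, 0]])

/-- The average of the two triangulations of the three-dimensional cube into five tetrahedra.
The central tetrahedron of such a triangulation is spanned by the vertices of even or of odd
parity, the remaining ones are the corners at the other vertices. The vertices of each tetrahedron
are in lexicographic order, and its sign is the orientation. -/
noncomputable def threeCubeChain : SingChain ℝ (Fin 3 → unitInterval) 3 :=
  (1 / 2 : ℝ) • (
      vertexSimplex ![![0, 0, 0], ![0, 1, 0], ![0, 1, 1], ![1, 1, 0]]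
      + vertexSimplex ![![0, 1, 1], ![1, 0, 1], ![1, 1, 0], ![1, 1, 1]]
      + vertexSimplex ![![0, 0, 0], ![0, 1, 1], ![1, 0, 1], ![1, 1, 0]]
      - vertexSimplex ![![0, 0, 0], ![0, 0, 1], ![0, 1, 1], ![1, 0, 1]]
      - vertexSimplex ![![0, 0, 0], ![1, 0, 0], ![1, 0, 1], ![1, 1, 0]]) +
    (1 / 2 : ℝ) • (
      vertexSimplex ![![0, 0, 1], ![0, 1, 0], ![0, 1, 1], ![1, 1, 1]]
      + vertexSimplex ![![0, 1, 0], ![1, 0, 0], ![1, 1, 0], ![1, 1, 1]]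
      - vertexSimplex ![![0, 0, 1], ![0, 1, 0], ![1, 0, 0], ![1, 1, 1]]
      - vertexSimplex ![![0, 0, 0], ![0, 0, 1], ![0, 1, 0], ![1, 0, 0]]
      - vertexSimplex ![![0, 0, 1], ![1, 0, 0], ![1, 0, 1], ![1, 1, 1]])

theorem l1Norm_threeCubeChain_le : l1Norm threeCubeChain ≤ 5 := by
  have h1 : ∀ v : Fin 4 → Fin 3 → unitInterval, l1Norm (vertexSimplex v) = 1 := fun v => by
    simp [vertexSimplex, l1Norm_single]
  have hadd : ∀ (x : SingChain ℝ (Fin 3 → unitInterval) 3) (v : Fin 4 → Fin 3 → unitInterval)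
      (r : ℝ≥0∞), l1Norm x ≤ r → l1Norm (x + vertexSimplex v) ≤ r + 1 := fun x v r hx =>
    (l1Norm_add_le _ _).trans (add_le_add hx (h1 v).le)
  have hsub : ∀ (x : SingChain ℝ (Fin 3 → unitInterval) 3) (v : Fin 4 → Fin 3 → unitInterval)
      (r : ℝ≥0∞), l1Norm x ≤ r → l1Norm (x - vertexSimplex v) ≤ r + 1 := fun x v r hx =>
    (l1Norm_sub_le _ _).trans (add_le_add hx (h1 v).le)
  have h5 : (1 + 1 + 1 + 1 + 1 : ℝ≥0∞) = 5 := by norm_num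
  have hhalf : ‖(1 / 2 : ℝ)‖ₑ + ‖(1 / 2 : ℝ)‖ₑ = 1 := by
    rw [Real.enorm_of_nonneg (by norm_num), ← ENNReal.ofReal_add (by norm_num) (by norm_num)]
    norm_num
  refine (l1Norm_add_le _ _).trans ?_
  rw [l1Norm_smul, l1Norm_smul, ← one_mul (5 : ℝ≥0∞), ← hhalf, add_mul]
  refine add_le_add ?_ ?_
  · gcongr
    rw [← h5]
    exact hsub _ _ _ (hsub _ _ _ (hadd _ _ _ (hadd _ _ _ (h1 _).le)))
  · gcongr
    rw [← h5]
    exact hsub _ _ _ (hsub _ _ _ (hsub _ _ _ (hadd _ _ _ (h1 _).le)))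

/-- The value of the chain map from cubical to singular chains on the fundamental chain of the
cube: in dimension at most three it is an average of triangulations, and in higher dimensions it
is obtained by coning off. -/
noncomputable def cubeModel : ∀ n, SingChain ℝ (Fin n → unitInterval) n
  | 0 => vertexSimplex ![![]]
  | 1 => vertexSimplex ![![0], ![1]]
  | 2 => squareChain
  | 3 => threeCubeChain
  | n + 4 => cone (cubeContraction (n + 4)) (n + 3)
      (modelOp _ (cubeModel (n + 3)) (cubeD _ (n + 3) (fundChain (Fin (n + 4) → unitInterval))))

theorem modelOp_cubeD_fundChain {n k : ℕ} (e : SingChain ℝ (Fin n → unitInterval) k) :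
    modelOp _ e (cubeD _ n (fundChain (Fin (n + 1) → unitInterval))) =
      ∑ j : Fin (n + 1), (-1 : ℝ) ^ ((j : ℕ) + 1) •
        (push (cubeFace n j 0) k e - push (cubeFace n j 1) k e) := by
  simp only [fundChain, cubeD_single, map_sum, map_smul, map_sub, modelOp_single, one_smul]
  rfl

theorem insertNth_zero_two (a b c : unitInterval) :
    (Fin.insertNth 0 a ![b, c] : Fin 3 → unitInterval) = ![a, b, c] := by
  funext i; fin_cases i <;> rfl

theorem insertNth_one_two (a b c : unitInterval) :
    (Fin.insertNth 1 a ![b, c] : Fin 3 → unitInterval) = ![b, a, c] := by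
  funext i; fin_cases i <;> rfl

theorem insertNth_two_two (a b c : unitInterval) :
    (Fin.insertNth 2 a ![b, c] : Fin 3 → unitInterval) = ![b, c, a] := by
  funext i; fin_cases i <;> rfl

theorem insertNth_zero_one (a b : unitInterval) :
    (Fin.insertNth 0 a ![b] : Fin 2 → unitInterval) = ![a, b] := by
  funext i; fin_cases i <;> rfl

theorem insertNth_one_one (a b : unitInterval) :
    (Fin.insertNth 1 a ![b] : Fin 2 → unitInterval) = ![b, a] := by
  funext i; fin_cases i <;> rfl

theorem singD_edge : singD ℝ _ 0 (cubeModel 1) =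
    modelOp _ (cubeModel 0) (cubeD _ 0 (fundChain (Fin 1 → unitInterval))) := by
  have h : ∀ a : unitInterval, (fun l => (0 : Fin 1).insertNth a (![![]] l : Fin 0 → unitInterval) :
      Fin 1 → Fin 1 → unitInterval) = ![![a]] := fun a => by
    funext l i; fin_cases l; fin_cases i; rfl
  rw [modelOp_cubeD_fundChain, Fin.sum_univ_one]
  simp only [cubeModel, singD_vertexSimplex_one, push_cubeFace_vertexSimplex, h]
  simp

theorem singD_square : singD ℝ _ 1 (cubeModel 2) =
    modelOp _ (cubeModel 1) (cubeD _ 1 (fundChain (Fin 2 → unitInterval))) := by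
  rw [modelOp_cubeD_fundChain, Fin.sum_univ_two]
  simp only [cubeModel, squareChain, map_add, map_sub, map_smul, singD_vertexSimplex_two,
    push_cubeFace_vertexSimplex, vertexSimplex_map_one, insertNth_zero_one, insertNth_one_one,
    Fin.val_zero, Fin.val_one]
  module

/-- Each face of the cube is triangulated by the two five-tetrahedra triangulations along
different diagonals, so that their average has the average triangulation of the faces as its
boundary. -/
theorem singD_threeCube : singD ℝ _ 2 (cubeModel 3) =
    modelOp _ (cubeModel 2) (cubeD _ 2 (fundChain (Fin 3 → unitInterval))) := by
  rw [modelOp_cubeD_fundChain, Fin.sum_univ_three]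
  simp only [cubeModel, squareChain, threeCubeChain, map_add, map_sub, map_smul,
    singD_vertexSimplex_three, push_cubeFace_vertexSimplex, vertexSimplex_map_two,
    insertNth_zero_two, insertNth_one_two, insertNth_two_two, Fin.val_zero, Fin.val_one,
    Fin.val_two]
  module

theorem singD_cubeModel : ∀ n, singD ℝ _ n (cubeModel (n + 1)) =
    modelOp _ (cubeModel n) (cubeD _ n (fundChain (Fin (n + 1) → unitInterval)))
  | 0 => singD_edge
  | 1 => singD_square
  | 2 => singD_threeCube
  | n + 3 => by
    refine singD_cone_of_cycle _ ?_
    rw [singD_modelOp, singD_cubeModel (n + 2), ← modelOp_cubeD, cubeD_cubeD, map_zero]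

/-- The chain map from cubical to singular chains given by the triangulations of cubes. -/
noncomputable def triangulate (X : Type v) [TopologicalSpace X] :
    Cplx.Hom (RingHom.id ℝ) (cube X) (sing ℝ X) where
  f n := modelOp X (cubeModel n)
  comm n c := by
    change CubeChain X (n + 1) at c
    change modelOp X (cubeModel n) (cubeD X n c) =
      singD ℝ X n (modelOp X (cubeModel (n + 1)) c)
    rw [modelOp_cubeD, singD_modelOp, singD_cubeModel]

end Triangulation

/-! ### The homotopy left inverse of the comparison map -/

section Inverse

/-- The chain map from cubical to singular chains: antisymmetrization, followed by
triangulation. -/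
noncomputable def cubToSing (X : Type v) [TopologicalSpace X] :
    Cplx.Hom (RingHom.id ℝ) (cub X) (sing ℝ X) :=
  (triangulate X).comp (antisymmHom X)

theorem singNorm_cubToSing_le {X : Type v} [TopologicalSpace X] (c : (cub X).C 3) :
    (1 / 5) * singNorm X 3 ((cubToSing X).f 3 c) ≤ cubNorm X 3 c := by
  refine le_iInf₂ fun b hb => ?_
  change CubeChain X 3 at b
  subst hb
  change (1 / 5) * l1Norm (modelOp X (cubeModel 3) (antisymm X 3 b)) ≤ l1Norm b
  calc (1 / 5) * l1Norm (modelOp X (cubeModel 3) (antisymm X 3 b))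
      ≤ (1 / 5) * (5 * l1Norm b) := by
        gcongr
        exact (l1Norm_modelOp_le _ _).trans
          (mul_le_mul' l1Norm_threeCubeChain_le (l1Norm_antisymm_le b))
    _ = l1Norm b := by
        rw [← mul_assoc, one_div, ENNReal.inv_mul_cancel (by simp) (by simp), one_mul]

/-- The model chain of the composition of the comparison map with `cubToSing`. -/
noncomputable def roundTripModel (n : ℕ) : SingChain ℝ (stdSimplex ℝ (Fin (n + 1))) n :=
  modelOp _ (cubeModel n) (antisymm _ n (Finsupp.single (collapse n) 1))

theorem cubToSing_singToCub {X : Type v} [TopologicalSpace X] {n : ℕ} (c : SingChain ℝ X n) :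
    (cubToSing X).f n ((singToCub X).f n c) = modelOp X (roundTripModel n) c := by
  refine LinearMap.congr_fun (eq_modelOp_of_natural
    ((modelOp X (cubeModel n)).comp ((antisymm X n).comp
      (Finsupp.lmapDomain ℝ ℝ fun τ : SingSimplex n X => τ.comp (collapse n))))
    (roundTripModel n) fun τ => ?_) c
  rw [LinearMap.comp_apply, LinearMap.comp_apply, roundTripModel, push_modelOp, ← antisymm_map]
  simp only [Finsupp.lmapDomain_apply, Finsupp.mapDomain_single]

theorem roundTripModel_zero : roundTripModel 0 = fundChain (stdSimplex ℝ (Fin 1)) := by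
  rw [roundTripModel, antisymm_zero, modelOp_single, one_smul]
  change push _ 0 (vertexSimplex _) = _
  rw [vertexSimplex, push_single, fundChain]
  congr 1
  exact ContinuousMap.ext fun t => Subsingleton.elim _ _

theorem singD_roundTripModel (n : ℕ) : singD ℝ _ n (roundTripModel (n + 1)) =
    modelOp _ (roundTripModel n) (singD ℝ _ n (fundChain (stdSimplex ℝ (Fin (n + 2))))) := by
  rw [← modelOp_fundChain (roundTripModel (n + 1)), ← cubToSing_singToCub, ← cubToSing_singToCub]
  have h1 := (singToCub (stdSimplex ℝ (Fin (n + 2)))).comm n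
    (fundChain (stdSimplex ℝ (Fin (n + 2))))
  have h2 := (cubToSing (stdSimplex ℝ (Fin (n + 2)))).comm n
    ((singToCub _).f (n + 1) (fundChain (stdSimplex ℝ (Fin (n + 2)))))
  rw [← h1] at h2
  exact h2.symm

/-- The model chains of the natural chain homotopy from the identity to the composition of the
comparison map with `cubToSing`, constructed by coning off in simplices. -/
noncomputable def homotopyModel : ∀ n, SingChain ℝ (stdSimplex ℝ (Fin (n + 1))) (n + 1)
  | 0 => 0
  | n + 1 => cone (simplexContraction (n + 1)) (n + 1)
      (roundTripModel (n + 1) - fundChain _ -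
        modelOp _ (homotopyModel n) (singD ℝ _ n (fundChain (stdSimplex ℝ (Fin (n + 2))))))

theorem singD_homotopyModel : ∀ n, singD ℝ _ (n + 1) (homotopyModel (n + 1)) =
    roundTripModel (n + 1) - fundChain (stdSimplex ℝ (Fin (n + 2))) -
      modelOp _ (homotopyModel n) (singD ℝ _ n (fundChain (stdSimplex ℝ (Fin (n + 2)))))
  | 0 => by
    refine singD_cone_of_cycle _ ?_
    rw [map_sub, map_sub, singD_roundTripModel, roundTripModel_zero, modelOp_fundChain_simplex,
      homotopyModel, modelOp_zero, map_zero, sub_self, sub_zero]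
  | n + 1 => by
    refine singD_cone_of_cycle _ ?_
    rw [map_sub, map_sub, singD_roundTripModel, singD_modelOp, singD_homotopyModel n,
      modelOp_sub, modelOp_sub, modelOp_fundChain_simplex, ← modelOp_singD, singD_singD, map_zero,
      sub_zero, sub_self]

/-- The comparison map has the homotopy left inverse `cubToSing`. -/
noncomputable def singToCubInverse (X : Type v) [TopologicalSpace X] :
    Cplx.HomotopyLeftInverse (singToCub X) where
  p := cubToSing X
  h n := modelOp X (homotopyModel n)
  homotopy n c := by
    change SingChain ℝ X (n + 1) at c
    have key : singD ℝ X (n + 1) (modelOp X (homotopyModel (n + 1)) c) +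
        modelOp X (homotopyModel n) (singD ℝ X n c) = modelOp X (roundTripModel (n + 1)) c - c := by
      rw [singD_modelOp, singD_homotopyModel, modelOp_sub, modelOp_sub,
        modelOp_fundChain_simplex, ← modelOp_singD, sub_add_cancel]
    exact key.trans
      (congrArg (fun x : SingChain ℝ X (n + 1) => x - c) (cubToSing_singToCub c).symm)

theorem cubToSing_sub {X : Type v} [TopologicalSpace X] (A : Set X) (n : ℕ) :
    (cubSub A).p n ≤ ((singSub ℝ A).p n).comap ((cubToSing X).f n) := by
  rintro _ ⟨c, rfl⟩
  obtain ⟨c, rfl⟩ := Submodule.Quotient.mk_surjective _ c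
  change CubeChain A n at c
  refine ⟨modelOp A (cubeModel n) (antisymm A n c), (push_modelOp (incl A) _ _).trans ?_⟩
  rw [← antisymm_map]
  rfl

theorem modelOp_sub_singSub {X : Type v} [TopologicalSpace X] (A : Set X) {n k : ℕ}
    (e : SingChain ℝ (stdSimplex ℝ (Fin (n + 1))) k) :
    (singSub ℝ A).p n ≤ ((singSub ℝ A).p k).comap (modelOp X e) := by
  rintro _ ⟨c, rfl⟩
  exact ⟨modelOp A e c, push_modelOp (incl A) e c⟩

end Inverse

/-! ### Comparison of the simplicial volumes -/

theorem cubicalSimplicialVolume_ge {M : Type v} [TopologicalSpace M] {B : Set M}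
    (o : Orientation 3 M B) : (1 / 5) * simplicialVolume o ≤ cubicalSimplicialVolume o := by
  refine le_iInf₂ fun α hα => le_trans ?_ (Cplx.HomotopyLeftInverse.mul_homologyNorm_le
    ((singToCubInverse M).quot (singSub ℝ B) (cubSub B) (singToCub_sub B) (cubToSing_sub B)
      fun n => modelOp_sub_singSub B (homotopyModel n))
    (Cplx.mul_quotNorm_le (cubToSing M) (cubSub B) (singSub ℝ B) (cubToSing_sub B)
      singNorm_cubToSing_le) α)
  gcongr
  exact iInf₂_le α hα

theorem singNorm_le_add_sub {X : Type v} [TopologicalSpace X] {n : ℕ} (a b : (sing ℝ X).C n) :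
    singNorm X n a ≤ singNorm X n b + singNorm X n (a - b) := by
  change SingChain ℝ X n at a b
  have := l1Norm_add_le b (a - b)
  rwa [add_sub_cancel] at this

theorem lfCubicalSimplicialVolume_ge {N : Type v} [TopologicalSpace N] [T2Space N]
    (o : Orientation 3 N (∅ : Set N)) :
    (1 / 5) * lfSimplicialVolume o ≤ lfCubicalSimplicialVolume o := by
  refine le_iInf₂ fun α hα => le_trans ?_ (Cplx.HomotopyLeftInverse.mul_homologyNorm_le
    ((singToCubInverse N).lim (singFar ℝ N) (cubFar N) (singFar_anti ℝ N) (cubFar_anti N)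
      (fun K => singToCub_sub (K : Set N)ᶜ) (fun K => cubToSing_sub (K : Set N)ᶜ)
      fun K n => modelOp_sub_singSub (K : Set N)ᶜ (homotopyModel n))
    (Cplx.mul_limNorm_le (cubToSing N) (cubFar N) (singFar ℝ N) (cubFar_anti N)
      (singFar_anti ℝ N) (fun K => cubToSing_sub (K : Set N)ᶜ) (by simp) (by simp)
      singNorm_cubToSing_le singNorm_le_add_sub) α)
  gcongr
  exact iInf₂_le α hα

end CubicalVolume

/-- For all oriented compact `3`-manifolds `M` (possibly with boundary) and all oriented
`3`-manifolds `N` without boundary, cubical simplicial volume is at least `1 / 5` of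
simplicial volume. -/
theorem corollary4p5 :
    (∀ (M : Type*) [TopologicalSpace M] [T2Space M] [SecondCountableTopology M] [CompactSpace M]
      [ChartedSpace (EuclideanHalfSpace 3) M]
      (o : CubicalVolume.Orientation 3 M ((𝓡∂ 3).boundary M)),
      CubicalVolume.cubicalSimplicialVolume o ≥ (1 / 5) * CubicalVolume.simplicialVolume o) ∧
    (∀ (N : Type*) [TopologicalSpace N] [T2Space N] [SecondCountableTopology N]
      [ChartedSpace (EuclideanSpace ℝ (Fin 3)) N]
      (o : CubicalVolume.Orientation 3 N (∅ : Set N)),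
      CubicalVolume.lfCubicalSimplicialVolume o ≥
        (1 / 5) * CubicalVolume.lfSimplicialVolume o) := by
  refine ⟨?_, ?_⟩
  · intro M _ _ _ _ _ o
    exact CubicalVolume.cubicalSimplicialVolume_ge o
  · intro N _ _ _ _ o
    exact CubicalVolume.lfCubicalSimplicialVolume_ge o
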